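/- Let $M$ be a connected smooth ($C^\infty$, Hausdorff, second countable) $3$-manifold with a contact metric structure $(\eta,\xi,\varphi,g)$: $\eta$ is a smooth one-form such that $\eta\wedge d\eta$ vanishes nowhere, $g$ is a smooth Riemannian metric, $\xi$ is a smooth vector field which is a unit field for $g$, and $\varphi$ is a smooth field of endomorphisms of $TM$, with $$\eta(\xi)=1,\qquad \varphi^2=-\mathrm{Id}+\eta\otimes\xi,\qquad \varphi\xi=0,\qquad d\eta(X,Y)=2g(X,\varphi Y),$$ where $d\eta(X,Y)=X(\eta(Y))-Y(\eta(X))-\eta([X,Y])$. Let $\nabla$ be the Levi-Civita connection of $g$, $R(X,Y)Z=\nabla_X\nabla_YZ-\nabla_Y\nabla_XZ-\nabla_{[X,Y]}Z$ its curvature tensor and $r$ its scalar curvature. Suppose that $M$ is a $\kappa$-space, that is, there is a smooth function $\kappa$ on $M$ with $$R(X,Y)\xi=\kappa\,(\eta(Y)X-\eta(X)Y)\qquad\text{for all vector fields } X,Y .$$ Assume that either 1. $\kappa\neq 0,1$, in the sense that $\kappa(x)\notin\{0,1\}$ for at least one point $x\in M$, or 2. $\kappa=1$ identically and $r\neq 6$,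 in the sense that $r$ is not identically equal to $6$. Then every infinitesimal isometry $Z$ of $(M,g)$ (a smooth vector field on $M$ with $L_Zg=0$) is an infinitesimal automorphism of the structure: $L_Z\eta=0$, $L_Z\xi=[Z,\xi]=0$, $L_Z\varphi=0$ and $L_Zg=0$. -/

import Mathlib

open Bundle FiberBundle VectorField
open scoped Manifold ContDiff

namespace KappaSpace

noncomputable section

section InnerDerivative

variable {E : Type*} [NormedAddCommGroup E] [NormedSpace ℝ E]
  {H : Type*} [TopologicalSpace H] {I : ModelWithCorners ℝ E H}
  {M : Type*} [TopologicalSpace M] [ChartedSpace H M]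
  {F : Type*} [NormedAddCommGroup F] [NormedSpace ℝ F]
  {V : M → Type*} [TopologicalSpace (TotalSpace F V)]
  [∀ x, NormedAddCommGroup (V x)] [∀ x, InnerProductSpace ℝ (V x)] [FiberBundle F V]
  [VectorBundle ℝ F V] [IsContMDiffRiemannianBundle I 1 F V] {x : M}
  {σ σ' τ : Π x : M, V x} {f : M → ℝ}

lemma mvfderiv_inner_smul_left (hf : MDiffAt f x) (hσ : MDiffAt (T% σ) x)
    (hτ : MDiffAt (T% τ) x) (v : TangentSpace I x) :
    mvfderiv I (fun y ↦ inner ℝ ((f • σ) y) (τ y)) x v =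
      f x * mvfderiv I (fun y ↦ inner ℝ (σ y) (τ y)) x v
        + inner ℝ (σ x) (τ x) * mvfderiv I f x v := by
  simp [mvfderiv_fun_mul hf (hσ.inner_bundle hτ), inner_smul_left]

lemma mvfderiv_inner_add_left (hσ : MDiffAt (T% σ) x) (hσ' : MDiffAt (T% σ') x)
    (hτ : MDiffAt (T% τ) x) (v : TangentSpace I x) :
    mvfderiv I (fun y ↦ inner ℝ ((σ + σ') y) (τ y)) x v =
      mvfderiv I (fun y ↦ inner ℝ (σ y) (τ y)) x v
        + mvfderiv I (fun y ↦ inner ℝ (σ' y) (τ y)) x v := by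
  simp [mvfderiv_fun_add (hσ.inner_bundle hτ) (hσ'.inner_bundle hτ), inner_add_left]

lemma mvfderiv_inner_comm :
    mvfderiv I (fun y ↦ inner ℝ (σ y) (τ y)) x = mvfderiv I (fun y ↦ inner ℝ (τ y) (σ y)) x := by
  simp only [real_inner_comm]

end InnerDerivative

section Connection

variable {E : Type*} [NormedAddCommGroup E] [NormedSpace ℝ E] [FiniteDimensional ℝ E]
  {H : Type*} [TopologicalSpace H] (I : ModelWithCorners ℝ E H)
  {M : Type*} [TopologicalSpace M] [ChartedSpace H M]
  [RiemannianBundle (fun x : M ↦ TangentSpace I x)]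

/-- The right hand side of the Koszul formula for `2 ⟨∇_X Y, Z⟩`, at the point `x`. -/
def koszul (X Y Z : Π x : M, TangentSpace I x) (x : M) : ℝ :=
  mvfderiv I (fun y ↦ inner ℝ (Y y) (Z y)) x (X x)
    + mvfderiv I (fun y ↦ inner ℝ (X y) (Z y)) x (Y x)
    - mvfderiv I (fun y ↦ inner ℝ (X y) (Y y)) x (Z x)
    + inner ℝ (mlieBracket I X Y x) (Z x)
    - inner ℝ (mlieBracket I X Z x) (Y x)
    - inner ℝ (mlieBracket I Y Z x) (X x)

variable [IsManifold I ∞ M] [IsContMDiffRiemannianBundle I ∞ E (fun x : M ↦ TangentSpace I x)]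

variable {I}

lemma koszul_tensorial_left {x : M} {Y Z : Π x : M, TangentSpace I x}
    (hY : MDiffAt (T% Y) x) (hZ : MDiffAt (T% Z) x) :
    TensorialAt I E (fun X : Π x : M, TangentSpace I x ↦ koszul I X Y Z x) x where
  smul {f X} hf hX := by
    have h1 := mvfderiv_inner_smul_left (V := fun x : M ↦ TangentSpace I x) hf hX hZ
    have h2 := mvfderiv_inner_smul_left (V := fun x : M ↦ TangentSpace I x) hf hX hY
    simp only [koszul, h1, h2, mlieBracket_smul_left hf hX]
    simp only [Pi.smul_apply', map_smul, inner_add_left, real_inner_smul_left,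
      real_inner_smul_right, smul_eq_mul]
    ring
  add {X X'} hX hX' := by
    have h1 := mvfderiv_inner_add_left (V := fun x : M ↦ TangentSpace I x) hX hX' hZ
    have h2 := mvfderiv_inner_add_left (V := fun x : M ↦ TangentSpace I x) hX hX' hY
    simp only [koszul, h1, h2, mlieBracket_add_left hX hX']
    simp only [Pi.add_apply, map_add, inner_add_left, inner_add_right]
    ring

lemma koszul_tensorial_right {x : M} {X Y : Π x : M, TangentSpace I x}
    (hX : MDiffAt (T% X) x) (hY : MDiffAt (T% Y) x) :
    TensorialAt I E (fun Z : Π x : M, TangentSpace I x ↦ koszul I X Y Z x) x where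
  smul {f Z} hf hZ := by
    have h1 := mvfderiv_inner_smul_left (V := fun x : M ↦ TangentSpace I x) hf hZ hX
    have h2 := mvfderiv_inner_smul_left (V := fun x : M ↦ TangentSpace I x) hf hZ hY
    simp only [koszul, mvfderiv_inner_comm (I := I) (τ := f • Z),
      mvfderiv_inner_comm (I := I) (τ := Z), h1, h2, mlieBracket_smul_right hf hZ]
    simp only [Pi.smul_apply', map_smul, inner_add_left, real_inner_smul_left,
      real_inner_smul_right, smul_eq_mul, real_inner_comm (X x) (Z x), real_inner_comm (Y x) (Z x)]
    ring
  add {Z Z'} hZ hZ' := by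
    have h1 := mvfderiv_inner_add_left (V := fun x : M ↦ TangentSpace I x) hZ hZ' hX
    have h2 := mvfderiv_inner_add_left (V := fun x : M ↦ TangentSpace I x) hZ hZ' hY
    simp only [koszul, mvfderiv_inner_comm (I := I) (τ := Z + Z'),
      mvfderiv_inner_comm (I := I) (τ := Z), mvfderiv_inner_comm (I := I) (τ := Z'),
      h1, h2, mlieBracket_add_right hZ hZ']
    simp only [Pi.add_apply, map_add, inner_add_left, inner_add_right]
    ring

/-- For a vector field `Y` differentiable at `x`, the bilinear form `(X, Z) ↦ 2 ⟨∇_X Y, Z⟩` on the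
tangent space at `x`, as given by the Koszul formula. -/
def koszulForm {x : M} {Y : Π x : M, TangentSpace I x} (hY : MDiffAt (T% Y) x) :
    TangentSpace I x →L[ℝ] TangentSpace I x →L[ℝ] ℝ :=
  TensorialAt.mkHom₂ (I := I) (F := E) (F' := E) (V := fun x : M ↦ TangentSpace I x)
    (V' := fun x : M ↦ TangentSpace I x) (fun X Z ↦ koszul I X Y Z x) x
    (fun _ hZ ↦ koszul_tensorial_left hY hZ) (fun _ hX ↦ koszul_tensorial_right hX hY)

lemma koszulForm_apply {x : M} {X Y Z : Π x : M, TangentSpace I x} (hX : MDiffAt (T% X) x)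
    (hY : MDiffAt (T% Y) x) (hZ : MDiffAt (T% Z) x) :
    koszulForm hY (X x) (Z x) = koszul I X Y Z x :=
  TensorialAt.mkHom₂_apply _ _ hX hZ

instance finiteDimensional_tangentSpace (x : M) : FiniteDimensional ℝ (TangentSpace I x) :=
  inferInstanceAs (FiniteDimensional ℝ E)

instance completeSpace_tangentSpace (x : M) : CompleteSpace (TangentSpace I x) := FiniteDimensional.complete ℝ _

open Classical in
/-- `leviCivitaFun Y x v` is `∇_v Y`: the tangent vector at `x` for which `2 ⟨∇_v Y, w⟩` is given by
the Koszul formula (with value zero if `Y` is not differentiable at `x`). -/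
def leviCivitaFun (Y : Π x : M, TangentSpace I x) (x : M) :
    TangentSpace I x →L[ℝ] TangentSpace I x :=
  if hY : MDiffAt (T% Y) x then
    LinearMap.toContinuousLinearMap
      { toFun := fun v ↦
          (InnerProductSpace.toDual ℝ (TangentSpace I x)).symm ((1 / 2 : ℝ) • koszulForm hY v)
        map_add' := fun v w ↦ by simp
        map_smul' := fun c v ↦ by simp [smul_smul, mul_comm] }
  else 0

lemma inner_leviCivitaFun {x : M} {X Y Z : Π x : M, TangentSpace I x} (hX : MDiffAt (T% X) x)
    (hY : MDiffAt (T% Y) x) (hZ : MDiffAt (T% Z) x) :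
    2 * inner ℝ (leviCivitaFun Y x (X x)) (Z x) = koszul I X Y Z x := by
  rw [← koszulForm_apply hX hY hZ]
  simp [leviCivitaFun, hY, real_inner_smul_left]

lemma leviCivitaFun_ext {x : M} {Y : Π x : M, TangentSpace I x} (hY : MDiffAt (T% Y) x)
    {A : TangentSpace I x →L[ℝ] TangentSpace I x}
    (h : ∀ X Z : Π x : M, TangentSpace I x, MDiffAt (T% X) x → MDiffAt (T% Z) x →
      koszul I X Y Z x = 2 * inner ℝ (A (X x)) (Z x)) :
    leviCivitaFun Y x = A := by
  ext1 v
  refine ext_inner_right ℝ fun w ↦ ?_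
  have hv := mdifferentiableAt_extend (V := fun x : M ↦ TangentSpace I x) I E v
  have hw := mdifferentiableAt_extend (V := fun x : M ↦ TangentSpace I x) I E w
  have h1 := inner_leviCivitaFun hv hY hw
  rw [h _ _ hv hw] at h1
  simpa using h1

variable (I M) in
/-- The Levi-Civita connection; `leviCivita I M Y x v` is `∇_v Y`. -/
def leviCivita : CovariantDerivative I E (fun x : M ↦ TangentSpace I x) where
  toFun := leviCivitaFun
  isCovariantDerivativeOnUniv :=
    { add := by
        intro Y Y' x hY hY' _
        refine leviCivitaFun_ext (mdifferentiableAt_add_section hY hY') fun X Z hX hZ ↦ ?_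
        have h1 := mvfderiv_inner_add_left (V := fun x : M ↦ TangentSpace I x) hY hY' hZ
        have h2 := mvfderiv_inner_add_left (V := fun x : M ↦ TangentSpace I x) hY hY' hX
        have h3 := inner_leviCivitaFun hX hY hZ
        have h4 := inner_leviCivitaFun hX hY' hZ
        simp only [koszul] at h3 h4
        simp only [koszul, mvfderiv_inner_comm (I := I) (σ := X) (τ := Y + Y'),
          mvfderiv_inner_comm (I := I) (σ := X) (τ := Y),
          mvfderiv_inner_comm (I := I) (σ := X) (τ := Y'), h1, h2,
          mlieBracket_add_left hY hY', mlieBracket_add_right hY hY'] at h3 h4 ⊢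
        simp only [Pi.add_apply, map_add, inner_add_left, inner_add_right,
          add_apply] at h3 h4 ⊢
        linarith
      leibniz := by
        intro Y f x hY hf _
        refine leviCivitaFun_ext (hf.smul_section hY) fun X Z hX hZ ↦ ?_
        have h1 := mvfderiv_inner_smul_left (V := fun x : M ↦ TangentSpace I x) hf hY hZ
        have h2 := mvfderiv_inner_smul_left (V := fun x : M ↦ TangentSpace I x) hf hY hX
        have h3 := inner_leviCivitaFun hX hY hZ
        simp only [koszul, mvfderiv_inner_comm (I := I) (σ := X) (τ := f • Y),
          mvfderiv_inner_comm (I := I) (σ := X) (τ := Y), h1, h2,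
          mlieBracket_smul_left hf hY, mlieBracket_smul_right hf hY] at h3 ⊢
        simp only [Pi.smul_apply', map_smul, inner_add_left, real_inner_smul_left,
          real_inner_smul_right, smul_eq_mul, add_apply,
          smul_apply, ContinuousLinearMap.smulRight_apply,
          real_inner_comm (X x) (Y x)] at h3 ⊢
        linear_combination (-f x) * h3 }

lemma inner_leviCivita {x : M} {X Y Z : Π x : M, TangentSpace I x} (hX : MDiffAt (T% X) x)
    (hY : MDiffAt (T% Y) x) (hZ : MDiffAt (T% Z) x) :
    2 * inner ℝ (leviCivita I M Y x (X x)) (Z x) = koszul I X Y Z x :=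
  inner_leviCivitaFun hX hY hZ

lemma leviCivita_torsion : (leviCivita I M).torsion = 0 := by
  rw [CovariantDerivative.torsion_eq_zero_iff]
  intro X Y x hX hY
  refine ext_inner_right ℝ fun w ↦ ?_
  have hw := mdifferentiableAt_extend (V := fun x : M ↦ TangentSpace I x) I E w
  have h1 := inner_leviCivita hX hY hw
  have h2 := inner_leviCivita hY hX hw
  simp only [koszul, mvfderiv_inner_comm (I := I) (σ := Y) (τ := X),
    mlieBracket_swap_apply (V := Y) (W := X), extend_apply_self, inner_neg_left] at h1 h2
  rw [inner_sub_left]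
  linarith

lemma leviCivita_isMetricCompatible :
    CovariantDerivative.IsMetricCompatible (V := fun x : M ↦ TangentSpace I x)
      (leviCivita I M) := by
  rw [CovariantDerivative.isMetricCompatible_iff]
  intro x X Y Z hX hY hZ
  have h1 := inner_leviCivita hX hY hZ
  have h2 := inner_leviCivita hX hZ hY
  simp only [koszul, mvfderiv_inner_comm (I := I) (σ := Z) (τ := Y),
    mlieBracket_swap_apply (V := Z) (W := Y), inner_neg_left] at h1 h2
  dsimp only
  rw [real_inner_comm (leviCivita I M Z x (X x)) (Y x)]
  linarith

end Connection

section Curvature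

variable {E : Type*} [NormedAddCommGroup E] [NormedSpace ℝ E] [FiniteDimensional ℝ E]
  {H : Type*} [TopologicalSpace H] (I : ModelWithCorners ℝ E H)
  {M : Type*} [TopologicalSpace M] [ChartedSpace H M]
  [RiemannianBundle (fun x : M ↦ TangentSpace I x)]
  [IsManifold I ∞ M] [IsContMDiffRiemannianBundle I ∞ E (fun x : M ↦ TangentSpace I x)]

/-- The vector field `R(X, Y) Z = ∇_X ∇_Y Z - ∇_Y ∇_X Z - ∇_[X, Y] Z`. -/
def curvature (X Y Z : Π x : M, TangentSpace I x) (x : M) : TangentSpace I x :=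
  leviCivita I M (fun y ↦ leviCivita I M Z y (Y y)) x (X x)
    - leviCivita I M (fun y ↦ leviCivita I M Z y (X y)) x (Y x)
    - leviCivita I M Z x (mlieBracket I X Y x)

/-- The curvature tensor at a point: `R(u, v) w`, computed with any smooth vector fields extending
the three tangent vectors near `x` (the choice is immaterial, since `R` is tensorial). -/
def curvatureAt (x : M) (u v w : TangentSpace I x) : TangentSpace I x :=
  curvature I (extend E u) (extend E v) (extend E w) x

/-- The Ricci tensor: `Ric(v, w)` is the trace of `u ↦ R(u, v) w`. -/
def ricci (x : M) (v w : TangentSpace I x) : ℝ :=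
  ∑ i, inner ℝ (curvatureAt I x (stdOrthonormalBasis ℝ (TangentSpace I x) i) v w)
    (stdOrthonormalBasis ℝ (TangentSpace I x) i)

/-- The scalar curvature `r`, the metric trace of the Ricci tensor. -/
def scalarCurvature (x : M) : ℝ :=
  ∑ i, ricci I x (stdOrthonormalBasis ℝ (TangentSpace I x) i)
    (stdOrthonormalBasis ℝ (TangentSpace I x) i)

end Curvature

section Contact

variable {E : Type*} [NormedAddCommGroup E] [NormedSpace ℝ E]
  {H : Type*} [TopologicalSpace H] (I : ModelWithCorners ℝ E H)
  {M : Type*} [TopologicalSpace M] [ChartedSpace H M]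

/-- `dη(X, Y) = X(η(Y)) - Y(η(X)) - η([X, Y])` (with no factor `1/2`). -/
def extDerivOneForm (η : Π x : M, TangentSpace I x →L[ℝ] ℝ) (X Y : Π x : M, TangentSpace I x)
    (x : M) : ℝ :=
  mvfderiv I (fun y ↦ η y (Y y)) x (X x) - mvfderiv I (fun y ↦ η y (X y)) x (Y x)
    - η x (mlieBracket I X Y x)

/-- `(η ∧ dη)(X, Y, Z)`. -/
def wedgeExtDeriv (η : Π x : M, TangentSpace I x →L[ℝ] ℝ) (X Y Z : Π x : M, TangentSpace I x)
    (x : M) : ℝ :=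
  η x (X x) * extDerivOneForm I η Y Z x + η x (Y x) * extDerivOneForm I η Z X x
    + η x (Z x) * extDerivOneForm I η X Y x

/-- The Lie derivative of a one-form: `(L_Z η)(X)`. -/
def lieDerivOneForm (Z : Π x : M, TangentSpace I x) (η : Π x : M, TangentSpace I x →L[ℝ] ℝ)
    (X : Π x : M, TangentSpace I x) (x : M) : ℝ :=
  mvfderiv I (fun y ↦ η y (X y)) x (Z x) - η x (mlieBracket I Z X x)

/-- The Lie derivative of an endomorphism of the tangent bundle: `(L_Z φ)(X)`. -/
def lieDerivEndo (Z : Π x : M, TangentSpace I x)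
    (φ : Π x : M, TangentSpace I x →L[ℝ] TangentSpace I x)
    (X : Π x : M, TangentSpace I x) (x : M) : TangentSpace I x :=
  mlieBracket I Z (fun y ↦ φ y (X y)) x - φ x (mlieBracket I Z X x)

variable [IsManifold I ∞ M] [RiemannianBundle (fun x : M ↦ TangentSpace I x)]

/-- The Lie derivative of the Riemannian metric: `(L_Z g)(X, Y)`. -/
def lieDerivMetric (Z X Y : Π x : M, TangentSpace I x) (x : M) : ℝ :=
  mvfderiv I (fun y ↦ inner ℝ (X y) (Y y)) x (Z x)
    - inner ℝ (mlieBracket I Z X x) (Y x) - inner ℝ (X x) (mlieBracket I Z Y x)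

/-- An infinitesimal isometry (Killing vector field): a smooth vector field `Z` on the manifold
with `L_Z g = 0`. -/
structure IsInfinitesimalIsometry (Z : Π x : M, TangentSpace I x) : Prop where
  smooth : CMDiff ∞ (T% Z)
  lieDeriv_metric : ∀ (x : M) (X Y : Π x : M, TangentSpace I x),
    CMDiffAt ∞ (T% X) x → CMDiffAt ∞ (T% Y) x → lieDerivMetric I Z X Y x = 0

variable (M) in
/-- A contact metric structure `(η, ξ, φ, g)` on a manifold of dimension three, the metric `g`
being the Riemannian metric carried by the tangent bundle. -/
structure ContactMetricStructure where
  /-- the contact form -/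
  η : Π x : M, TangentSpace I x →L[ℝ] ℝ
  /-- the Reeb vector field -/
  ξ : Π x : M, TangentSpace I x
  /-- the structure endomorphism -/
  φ : Π x : M, TangentSpace I x →L[ℝ] TangentSpace I x
  smooth_η : ContMDiff I (I.prod 𝓘(ℝ, E →L[ℝ] ℝ)) ∞
    (fun x ↦ TotalSpace.mk' (E →L[ℝ] ℝ)
      (E := fun x : M ↦ TangentSpace I x →L[ℝ] Bundle.Trivial M ℝ x) x (η x))
  smooth_ξ : CMDiff ∞ (T% ξ)
  smooth_φ : ContMDiff I (I.prod 𝓘(ℝ, E →L[ℝ] E)) ∞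
    (fun x ↦ TotalSpace.mk' (E →L[ℝ] E)
      (E := fun x : M ↦ TangentSpace I x →L[ℝ] TangentSpace I x) x (φ x))
  /-- `η ∧ dη` is a volume form: it vanishes at no point. -/
  contact : ∀ x : M, ∃ X Y Z : Π x : M, TangentSpace I x,
    CMDiffAt ∞ (T% X) x ∧ CMDiffAt ∞ (T% Y) x ∧ CMDiffAt ∞ (T% Z) x ∧
      wedgeExtDeriv I η X Y Z x ≠ 0
  unit_ξ : ∀ x : M, inner ℝ (ξ x) (ξ x) = (1 : ℝ)
  η_ξ : ∀ x : M, η x (ξ x) = 1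
  φ_φ : ∀ (x : M) (v : TangentSpace I x), φ x (φ x v) = -v + η x v • ξ x
  φ_ξ : ∀ x : M, φ x (ξ x) = 0
  /-- `dη = 2 g(·, φ ·)` -/
  extDeriv_η : ∀ (x : M) (X Y : Π x : M, TangentSpace I x),
    CMDiffAt ∞ (T% X) x → CMDiffAt ∞ (T% Y) x →
      extDerivOneForm I η X Y x = 2 * inner ℝ (X x) (φ x (Y x))

variable {I}

/-- The vector field `Z` is an infinitesimal automorphism of the structure `(η, ξ, φ, g)`: its Lie
derivatives `L_Z η`, `L_Z ξ = [Z, ξ]`, `L_Z φ` and `L_Z g` all vanish. -/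
structure ContactMetricStructure.IsInfinitesimalAutomorphism (S : ContactMetricStructure I M)
    (Z : Π x : M, TangentSpace I x) : Prop where
  smooth : CMDiff ∞ (T% Z)
  lieDeriv_η : ∀ (x : M) (X : Π x : M, TangentSpace I x),
    CMDiffAt ∞ (T% X) x → lieDerivOneForm I Z S.η X x = 0
  lieDeriv_ξ : ∀ x : M, mlieBracket I Z S.ξ x = 0
  lieDeriv_φ : ∀ (x : M) (X : Π x : M, TangentSpace I x),
    CMDiffAt ∞ (T% X) x → lieDerivEndo I Z S.φ X x = 0
  lieDeriv_metric : ∀ (x : M) (X Y : Π x : M, TangentSpace I x),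
    CMDiffAt ∞ (T% X) x → CMDiffAt ∞ (T% Y) x → lieDerivMetric I Z X Y x = 0

variable [FiniteDimensional ℝ E]
  [IsContMDiffRiemannianBundle I ∞ E (fun x : M ↦ TangentSpace I x)]

/-- The contact metric structure is a `κ`-structure for the smooth function `κ`:
`R(X, Y) ξ = κ (η(Y) X - η(X) Y)` for all vector fields `X`, `Y`. -/
structure ContactMetricStructure.IsKappaSpace (S : ContactMetricStructure I M) (κ : M → ℝ) :
    Prop where
  smooth : CMDiff ∞ κ
  curvature_ξ : ∀ (x : M) (X Y : Π x : M, TangentSpace I x),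
    CMDiffAt ∞ (T% X) x → CMDiffAt ∞ (T% Y) x →
      curvature I X Y S.ξ x = κ x • (S.η x (Y x) • X x - S.η x (X x) • Y x)

end Contact

end

end KappaSpace

namespace KappaSpace

noncomputable section

section Calculus

set_option linter.unusedSectionVars false

variable {E : Type*} [NormedAddCommGroup E] [NormedSpace ℝ E]
  {H : Type*} [TopologicalSpace H] {I : ModelWithCorners ℝ E H}
  {M : Type*} [TopologicalSpace M] [ChartedSpace H M] [IsManifold I ∞ M]

/-- The vector field `X` is smooth on the open set `U`. -/
def SmoothField (U : TopologicalSpace.Opens M) (X : Π x : M, TangentSpace I x) : Prop :=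
  ∀ x ∈ U, CMDiffAt ∞ (T% X) x

variable (I) in
/-- The function `f` is smooth on the open set `U`. -/
def SmoothFun (U : TopologicalSpace.Opens M) (f : M → ℝ) : Prop :=
  ∀ x ∈ U, CMDiffAt ∞ f x

/-- The derivative of the function `f` along the vector field `X`. -/
def dirDeriv (X : Π x : M, TangentSpace I x) (f : M → ℝ) (x : M) : ℝ :=
  mvfderiv I f x (X x)

variable {U V : TopologicalSpace.Opens M} {f g : M → ℝ} {x : M}
  {X X' Y Y' Z : Π x : M, TangentSpace I x}

lemma SmoothField.mdiffAt (hX : SmoothField U X) (hx : x ∈ U) : MDiffAt (T% X) x :=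
  (hX x hx).mdifferentiableAt (by simp)

lemma SmoothFun.mdiffAt (hf : SmoothFun I U f) (hx : x ∈ U) : MDiffAt f x :=
  (hf x hx).mdifferentiableAt (by simp)

lemma SmoothField.mono (hX : SmoothField U X) (h : V ≤ U) : SmoothField V X :=
  fun x hx ↦ hX x (h hx)

lemma SmoothFun.mono (hf : SmoothFun I U f) (h : V ≤ U) : SmoothFun I V f :=
  fun x hx ↦ hf x (h hx)

lemma eventuallyEq_of_opens {α : M → Type*} {X Y : Π x, α x} (h : ∀ y ∈ U, X y = Y y)
    (hx : x ∈ U) : ∀ᶠ y in nhds x, X y = Y y :=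
  Filter.eventually_of_mem (U.isOpen.mem_nhds hx) h

lemma SmoothFun.congr (hf : SmoothFun I U f) (h : ∀ y ∈ U, g y = f y) : SmoothFun I U g :=
  fun x hx ↦ (hf x hx).congr_of_eventuallyEq (eventuallyEq_of_opens h hx)

lemma SmoothField.congr (hX : SmoothField U X) (h : ∀ y ∈ U, Y y = X y) : SmoothField U Y :=
  fun x hx ↦ (hX x hx).congr_of_eventuallyEq
    ((eventuallyEq_of_opens h hx).mono fun y hy ↦ by simp [hy])

lemma SmoothFun.const (c : ℝ) : SmoothFun I U (fun _ ↦ c) := fun _ _ ↦ contMDiffAt_const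

lemma SmoothFun.add (hf : SmoothFun I U f) (hg : SmoothFun I U g) :
    SmoothFun I U (fun x ↦ f x + g x) := fun x hx ↦ (hf x hx).add (hg x hx)

lemma SmoothFun.sub (hf : SmoothFun I U f) (hg : SmoothFun I U g) :
    SmoothFun I U (fun x ↦ f x - g x) := fun x hx ↦ (hf x hx).sub (hg x hx)

lemma SmoothFun.neg (hf : SmoothFun I U f) : SmoothFun I U (fun x ↦ - f x) :=
  fun x hx ↦ (hf x hx).neg

lemma SmoothFun.mul (hf : SmoothFun I U f) (hg : SmoothFun I U g) :
    SmoothFun I U (fun x ↦ f x * g x) := fun x hx ↦ (hf x hx).mul (hg x hx)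

lemma SmoothFun.sqrt (hf : SmoothFun I U f) (h : ∀ x ∈ U, 0 < f x) :
    SmoothFun I U (fun x ↦ √(f x)) := fun x hx ↦
  (Real.contDiffAt_sqrt (h x hx).ne').comp_contMDiffAt (hf x hx)

lemma SmoothFun.inv (hf : SmoothFun I U f) (h : ∀ x ∈ U, f x ≠ 0) :
    SmoothFun I U (fun x ↦ (f x)⁻¹) := fun x hx ↦
  (contDiffAt_inv ℝ (h x hx)).comp_contMDiffAt (hf x hx)

lemma dirDeriv_congr (h : ∀ y ∈ U, f y = g y) (hx : x ∈ U) : dirDeriv X f x = dirDeriv X g x := by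
  have : mfderiv I 𝓘(ℝ, ℝ) f x = mfderiv I 𝓘(ℝ, ℝ) g x :=
    Filter.EventuallyEq.mfderiv_eq (eventuallyEq_of_opens h hx)
  simp only [dirDeriv, mvfderiv]
  rw [this, h x hx]

lemma dirDeriv_const (c : ℝ) : dirDeriv X (fun _ ↦ c) x = 0 := by
  simp [dirDeriv, mvfderiv_const]

lemma dirDeriv_eq_zero_of_const {c : ℝ} (h : ∀ y ∈ U, f y = c) (hx : x ∈ U) :
    dirDeriv X f x = 0 := by
  rw [dirDeriv_congr h hx, dirDeriv_const]

lemma dirDeriv_add (hf : SmoothFun I U f) (hg : SmoothFun I U g) (hx : x ∈ U) :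
    dirDeriv X (fun x ↦ f x + g x) x = dirDeriv X f x + dirDeriv X g x := by
  simp [dirDeriv, mvfderiv_fun_add (hf.mdiffAt hx) (hg.mdiffAt hx)]

lemma dirDeriv_sub (hf : SmoothFun I U f) (hg : SmoothFun I U g) (hx : x ∈ U) :
    dirDeriv X (fun x ↦ f x - g x) x = dirDeriv X f x - dirDeriv X g x := by
  simp [dirDeriv, mvfderiv_fun_sub (hf.mdiffAt hx) (hg.mdiffAt hx)]

lemma dirDeriv_neg : dirDeriv X (fun x ↦ - f x) x = - dirDeriv X f x := by
  simp [dirDeriv, mvfderiv_fun_neg]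

lemma dirDeriv_mul (hf : SmoothFun I U f) (hg : SmoothFun I U g) (hx : x ∈ U) :
    dirDeriv X (fun x ↦ f x * g x) x = f x * dirDeriv X g x + g x * dirDeriv X f x := by
  simp [dirDeriv, mvfderiv_fun_mul (hf.mdiffAt hx) (hg.mdiffAt hx)]

lemma SmoothField.add (hX : SmoothField U X) (hY : SmoothField U Y) : SmoothField U (X + Y) :=
  fun x hx ↦ (hX x hx).add_section (hY x hx)

lemma SmoothField.sub (hX : SmoothField U X) (hY : SmoothField U Y) : SmoothField U (X - Y) :=
  fun x hx ↦ (hX x hx).sub_section (hY x hx)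

lemma SmoothField.smul (hf : SmoothFun I U f) (hX : SmoothField U X) : SmoothField U (f • X) :=
  fun x hx ↦ (hf x hx).smul_section (hX x hx)

variable [CompleteSpace E]

lemma SmoothField.lieBracket (hX : SmoothField U X) (hY : SmoothField U Y) :
    SmoothField U (mlieBracket I X Y) := fun x hx ↦ by
  have : IsManifold I (((⊤ : ℕ∞) : WithTop ℕ∞) + 1) M := inferInstanceAs (IsManifold I ∞ M)
  have : IsManifold I (minSmoothness ℝ 2) M := by
    rw [minSmoothness_of_isRCLikeNormedField]; infer_instance
  exact (hX x hx).mlieBracket_vectorField (n := ⊤) (m := ⊤) (hY x hx) (by simp)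

lemma lieBracket_congr (hX : ∀ y ∈ U, X y = X' y) (hY : ∀ y ∈ U, Y y = Y' y) (hx : x ∈ U) :
    mlieBracket I X Y x = mlieBracket I X' Y' x :=
  Filter.EventuallyEq.mlieBracket_vectorField_eq (eventuallyEq_of_opens hX hx)
    (eventuallyEq_of_opens hY hx)

lemma lieBracket_smul_right (hf : SmoothFun I U f) (hY : SmoothField U Y) (hx : x ∈ U) :
    mlieBracket I X (f • Y) x = dirDeriv X f x • Y x + f x • mlieBracket I X Y x :=
  mlieBracket_smul_right (hf.mdiffAt hx) (hY.mdiffAt hx)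

lemma jacobi (hX : SmoothField U X) (hY : SmoothField U Y) (hZ : SmoothField U Z) (hx : x ∈ U) :
    mlieBracket I X (mlieBracket I Y Z) x =
      mlieBracket I (mlieBracket I X Y) Z x + mlieBracket I Y (mlieBracket I X Z) x := by
  have h : minSmoothness ℝ 2 ≤ ∞ := by
    rw [minSmoothness_of_isRCLikeNormedField]; exact ENat.LEInfty.out
  have : IsManifold I (minSmoothness ℝ 3) M := by
    rw [minSmoothness_of_isRCLikeNormedField]; infer_instance
  exact leibniz_identity_mlieBracket_apply ((hX x hx).of_le h) ((hY x hx).of_le h)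
    ((hZ x hx).of_le h)

end Calculus

section LinearAlgebra

variable {V : Type*} [NormedAddCommGroup V] [InnerProductSpace ℝ V]

lemma eq_sum_of_orthonormal (hV : Module.finrank ℝ V = 3) {a b c : V}
    (ha : inner ℝ a a = (1 : ℝ)) (hb : inner ℝ b b = (1 : ℝ)) (hc : inner ℝ c c = (1 : ℝ))
    (hab : inner ℝ a b = (0 : ℝ)) (hac : inner ℝ a c = (0 : ℝ)) (hbc : inner ℝ b c = (0 : ℝ))
    (v : V) :
    v = (inner ℝ v a : ℝ) • a + (inner ℝ v b : ℝ) • b + (inner ℝ v c : ℝ) • c := by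
  have hba : inner ℝ b a = (0 : ℝ) := by rw [real_inner_comm, hab]
  have hca : inner ℝ c a = (0 : ℝ) := by rw [real_inner_comm, hac]
  have hcb : inner ℝ c b = (0 : ℝ) := by rw [real_inner_comm, hbc]
  have h : Orthonormal ℝ ![a, b, c] := by
    rw [orthonormal_iff_ite]
    intro i j
    fin_cases i <;> fin_cases j <;> simp [*] <;> simp_all
  have : FiniteDimensional ℝ V := Module.finite_of_finrank_eq_succ hV
  have hcard : Fintype.card (Fin 3) = Module.finrank ℝ V := by simp [hV]
  let B := (basisOfOrthonormalOfCardEqFinrank h hcard).toOrthonormalBasis (by simpa using h)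
  have h1 := B.sum_repr' v
  have hB : ∀ i, B i = ![a, b, c] i := by simp [B]
  simp only [hB, Fin.sum_univ_three] at h1
  simp only [Matrix.cons_val, real_inner_comm v] at h1
  exact h1.symm

end LinearAlgebra

section Riemannian

set_option linter.unusedSectionVars false

variable {E : Type*} [NormedAddCommGroup E] [NormedSpace ℝ E] [FiniteDimensional ℝ E]
  {H : Type*} [TopologicalSpace H] {I : ModelWithCorners ℝ E H}
  {M : Type*} [TopologicalSpace M] [ChartedSpace H M]
  [RiemannianBundle (fun x : M ↦ TangentSpace I x)]
  [IsManifold I ∞ M] [IsContMDiffRiemannianBundle I ∞ E (fun x : M ↦ TangentSpace I x)]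
  {U V : TopologicalSpace.Opens M} {f g : M → ℝ} {x : M}
  {X X' Y Y' Z T : Π x : M, TangentSpace I x}

/-- The vector field `∇_X Y`. -/
def cov (X Y : Π x : M, TangentSpace I x) (x : M) : TangentSpace I x :=
  leviCivita I M Y x (X x)

lemma smoothFun_inner (hX : SmoothField U X) (hY : SmoothField U Y) :
    SmoothFun I U (fun x ↦ inner ℝ (X x) (Y x)) :=
  fun x hx ↦ ContMDiffAt.inner_bundle (E := fun x : M ↦ TangentSpace I x) (hX x hx) (hY x hx)

lemma cov_congr_right (hY : SmoothField U Y) (h : ∀ y ∈ U, Y y = Y' y) (hx : x ∈ U) :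
    cov X Y x = cov X Y' x := by
  have hY' : SmoothField U Y' := hY.congr fun y hy ↦ (h y hy).symm
  simp only [cov]
  congr 1
  exact
    ((leviCivita I M).isCovariantDerivativeOnUniv.mono (Set.subset_univ (U : Set M))).congr_of_eqOn
    (hY.mdiffAt hx) (hY'.mdiffAt hx) (U.isOpen.mem_nhds hx) h

lemma cov_add_right (hY : SmoothField U Y) (hZ : SmoothField U Z) (hx : x ∈ U) :
    cov X (Y + Z) x = cov X Y x + cov X Z x := by
  simp only [cov]
  rw [(leviCivita I M).isCovariantDerivativeOnUniv.add (hY.mdiffAt hx) (hZ.mdiffAt hx)]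
  rfl

lemma cov_sub_cov (hX : SmoothField U X) (hY : SmoothField U Y) (hx : x ∈ U) :
    cov X Y x - cov Y X x = mlieBracket I X Y x :=
  (leviCivita I M).torsion_eq_zero_iff.1 leviCivita_torsion (hX.mdiffAt hx) (hY.mdiffAt hx)

lemma dirDeriv_inner (hX : SmoothField U X) (hY : SmoothField U Y) (hZ : SmoothField U Z)
    (hx : x ∈ U) : dirDeriv X (fun y ↦ inner ℝ (Y y) (Z y)) x =
      inner ℝ (cov X Y x) (Z x) + inner ℝ (Y x) (cov X Z x) :=
  (CovariantDerivative.isMetricCompatible_iff (V := fun x : M ↦ TangentSpace I x) _).1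
    leviCivita_isMetricCompatible (hX.mdiffAt hx) (hY.mdiffAt hx) (hZ.mdiffAt hx)

lemma two_mul_inner_cov (hX : SmoothField U X) (hY : SmoothField U Y) (hZ : SmoothField U Z)
    (hx : x ∈ U) : 2 * inner ℝ (cov X Y x) (Z x) = koszul I X Y Z x :=
  inner_leviCivita (hX.mdiffAt hx) (hY.mdiffAt hx) (hZ.mdiffAt hx)

lemma smoothFun_dirDeriv (hT : SmoothField U T) (hT1 : ∀ y ∈ U, inner ℝ (T y) (T y) = (1 : ℝ))
    (hX : SmoothField U X) (hf : SmoothFun I U f) : SmoothFun I U (dirDeriv X f) := by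
  have : CompleteSpace E := FiniteDimensional.complete ℝ E
  refine ((smoothFun_inner (hX.lieBracket (hT.smul hf)) hT).sub
    (hf.mul (smoothFun_inner (hX.lieBracket hT) hT))).congr fun y hy ↦ ?_
  rw [lieBracket_smul_right hf hT hy, inner_add_left, real_inner_smul_left, real_inner_smul_left,
    hT1 y hy]
  ring

lemma dirDeriv_lieBracket (hT : SmoothField U T)
    (hT1 : ∀ y ∈ U, inner ℝ (T y) (T y) = (1 : ℝ))
    (hX : SmoothField U X) (hY : SmoothField U Y) (hf : SmoothFun I U f) (hx : x ∈ U) :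
    dirDeriv (mlieBracket I X Y) f x =
      dirDeriv X (dirDeriv Y f) x - dirDeriv Y (dirDeriv X f) x := by
  have : CompleteSpace E := FiniteDimensional.complete ℝ E
  have key := jacobi hX hY (hT.smul hf) hx
  have e : ∀ {X : Π x : M, TangentSpace I x} (y) (hy : y ∈ U),
      mlieBracket I X (f • T) y = (dirDeriv X f • T + f • mlieBracket I X T) y := by
    intro X y hy
    simp [lieBracket_smul_right hf hT hy]
  rw [lieBracket_congr (fun y hy ↦ rfl) (e (X := Y)) hx,
    lieBracket_congr (fun y hy ↦ rfl) (e (X := X)) hx, e x hx] at key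
  have a : ∀ {X Y : Π x : M, TangentSpace I x}, SmoothField U X → SmoothField U Y →
      mlieBracket I X (dirDeriv Y f • T + f • mlieBracket I Y T) x =
        dirDeriv X (dirDeriv Y f) x • T x
        + dirDeriv Y f x • mlieBracket I X T x + dirDeriv X f x •
        mlieBracket I Y T x + f x • mlieBracket I X (mlieBracket I Y T) x := by
    intro X Y hX hY
    have h1 := smoothFun_dirDeriv hT hT1 hY hf
    rw [mlieBracket_add_right ((hT.smul h1).mdiffAt hx) (((hY.lieBracket hT).smul hf).mdiffAt hx),
      lieBracket_smul_right h1 hT hx, lieBracket_smul_right hf (hY.lieBracket hT) hx]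
    module
  rw [a hX hY, a hY hX, jacobi hX hY hT hx] at key
  have := congrArg (fun v ↦ inner ℝ v (T x)) key
  simp only [Pi.add_apply, Pi.smul_apply', inner_add_left, real_inner_smul_left, hT1 x hx,
    smul_add] at this
  linarith

end Riemannian

section ContactMetric

set_option linter.unusedSectionVars false

variable {E : Type*} [NormedAddCommGroup E] [NormedSpace ℝ E] [FiniteDimensional ℝ E]
  {H : Type*} [TopologicalSpace H] {I : ModelWithCorners ℝ E H}
  {M : Type*} [TopologicalSpace M] [ChartedSpace H M]
  [RiemannianBundle (fun x : M ↦ TangentSpace I x)]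
  [IsManifold I ∞ M] [IsContMDiffRiemannianBundle I ∞ E (fun x : M ↦ TangentSpace I x)]
  {U V : TopologicalSpace.Opens M} {f g : M → ℝ} {x : M}
  {X Y Z T : Π x : M, TangentSpace I x} (S : ContactMetricStructure I M)

namespace ContactMetricStructure

/-- The vector field `φ X`. -/
def endo (X : Π x : M, TangentSpace I x) (x : M) : TangentSpace I x := S.φ x (X x)

lemma smoothField_ξ : SmoothField U S.ξ := fun x _ ↦ S.smooth_ξ x

lemma endo_apply : S.endo X x = S.φ x (X x) := rfl

lemma _root_.KappaSpace.SmoothField.endo (hX : SmoothField U X) : SmoothField U (S.endo X) :=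
  fun x hx ↦ ContMDiffAt.clm_bundle_apply (E₁ := fun x : M ↦ TangentSpace I x)
    (E₂ := fun x : M ↦ TangentSpace I x) (S.smooth_φ x) (hX x hx)

lemma inner_φ_right (u v : TangentSpace I x) : inner ℝ u (S.φ x v) = -inner ℝ (S.φ x u) v := by
  have hu := contMDiffAt_extend (V := fun x : M ↦ TangentSpace I x) (k := ∞) I E u
  have hv := contMDiffAt_extend (V := fun x : M ↦ TangentSpace I x) (k := ∞) I E v
  have h1 := S.extDeriv_η x _ _ hu hv
  have h2 := S.extDeriv_η x _ _ hv hu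
  simp only [extDerivOneForm] at h1 h2
  rw [mlieBracket_swap_apply, map_neg] at h2
  simp only [extend_apply_self] at h1 h2
  rw [real_inner_comm v]
  linarith

lemma inner_φ_left (u v : TangentSpace I x) : inner ℝ (S.φ x u) v = -inner ℝ u (S.φ x v) := by
  rw [inner_φ_right, neg_neg]

lemma η_apply (v : TangentSpace I x) : S.η x v = inner ℝ (S.ξ x) v := by
  have h : ∀ u v : TangentSpace I x, inner ℝ (S.φ x u) (S.φ x v) =
      inner ℝ u v - S.η x u * inner ℝ (S.ξ x) v := by
    intro u v
    rw [inner_φ_right, S.φ_φ, inner_add_left, inner_neg_left, real_inner_smul_left]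
    ring
  have h1 := h (S.ξ x) v
  have h2 := h v (S.ξ x)
  rw [S.φ_ξ, inner_zero_left, S.η_ξ] at h1
  rw [S.φ_ξ, inner_zero_right, S.unit_ξ, real_inner_comm] at h2
  linarith

lemma φ_sq (v : TangentSpace I x) :
    S.φ x (S.φ x v) = -v + (inner ℝ (S.ξ x) v : ℝ) • S.ξ x := by
  rw [S.φ_φ, η_apply]

lemma inner_φ_φ (u v : TangentSpace I x) : inner ℝ (S.φ x u) (S.φ x v) =
    inner ℝ u v - inner ℝ (S.ξ x) u * inner ℝ (S.ξ x) v := by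
  rw [inner_φ_right, S.φ_sq, inner_add_left, inner_neg_left, real_inner_smul_left]
  ring

lemma inner_ξ_φ (v : TangentSpace I x) : inner ℝ (S.ξ x) (S.φ x v) = (0 : ℝ) := by
  rw [inner_φ_right, S.φ_ξ, inner_zero_left, neg_zero]

lemma inner_φ_ξ (v : TangentSpace I x) : inner ℝ (S.φ x v) (S.ξ x) = (0 : ℝ) := by
  rw [real_inner_comm, inner_ξ_φ]

lemma inner_self_φ (v : TangentSpace I x) : inner ℝ v (S.φ x v) = (0 : ℝ) := by
  have := S.inner_φ_right v v
  rw [real_inner_comm v] at this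
  linarith

lemma inner_φ_self (v : TangentSpace I x) : inner ℝ (S.φ x v) v = (0 : ℝ) := by
  rw [real_inner_comm, inner_self_φ]

/-- The skew part of `∇ξ` is `-φ`. -/
lemma inner_cov_ξ_sub (hX : SmoothField U X) (hY : SmoothField U Y) (hx : x ∈ U) :
    inner ℝ (cov X S.ξ x) (Y x) - inner ℝ (cov Y S.ξ x) (X x) =
      2 * inner ℝ (X x) (S.φ x (Y x)) := by
  have h := S.extDeriv_η x X Y (hX x hx) (hY x hx)
  have h1 := dirDeriv_inner hX S.smoothField_ξ hY hx
  have h2 := dirDeriv_inner hY S.smoothField_ξ hX hx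
  simp only [extDerivOneForm, S.η_apply, ← cov_sub_cov hX hY hx, inner_sub_right] at h
  simp only [dirDeriv] at h1 h2
  linarith

lemma inner_cov_ξ_ξ (hX : SmoothField U X) (hx : x ∈ U) :
    inner ℝ (cov X S.ξ x) (S.ξ x) = (0 : ℝ) := by
  have h := dirDeriv_inner hX S.smoothField_ξ S.smoothField_ξ hx
  rw [dirDeriv_eq_zero_of_const (fun y _ ↦ S.unit_ξ y) hx, real_inner_comm (cov X S.ξ x)] at h
  linarith

/-- The unit vector field `X` on `U`, orthogonal to `ξ`, and the fields `ξ` and `φ X` form an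
orthonormal frame. -/
structure IsAdapted (U : TopologicalSpace.Opens M) (X : Π x : M, TangentSpace I x) : Prop where
  smooth : SmoothField U X
  unit : ∀ x ∈ U, inner ℝ (X x) (X x) = (1 : ℝ)
  orth : ∀ x ∈ U, inner ℝ (S.ξ x) (X x) = (0 : ℝ)

variable {S}

lemma IsAdapted.mono (hX : S.IsAdapted U X) (h : V ≤ U) : S.IsAdapted V X :=
  ⟨hX.smooth.mono h, fun x hx ↦ hX.unit x (h hx), fun x hx ↦ hX.orth x (h hx)⟩

lemma IsAdapted.orth' (hX : S.IsAdapted U X) (hx : x ∈ U) :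
    inner ℝ (X x) (S.ξ x) = (0 : ℝ) := by
  rw [real_inner_comm, hX.orth x hx]

lemma IsAdapted.inner_φ_φ (hX : S.IsAdapted U X) (hx : x ∈ U) :
    inner ℝ (S.φ x (X x)) (S.φ x (X x)) = (1 : ℝ) := by
  rw [S.inner_φ_φ, hX.unit x hx, hX.orth x hx, mul_zero, sub_zero]

lemma IsAdapted.φ_φ (hX : S.IsAdapted U X) (hx : x ∈ U) :
    S.φ x (S.φ x (X x)) = - X x := by
  rw [S.φ_sq, hX.orth x hx, zero_smul, add_zero]

lemma IsAdapted.eq_sum (hX : S.IsAdapted U X) (hE : Module.finrank ℝ E = 3) (hx : x ∈ U)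
    (v : TangentSpace I x) : v = (inner ℝ v (S.ξ x) : ℝ) • S.ξ x + (inner ℝ v (X x) : ℝ) • X x
      + (inner ℝ v (S.φ x (X x)) : ℝ) • S.φ x (X x) :=
  eq_sum_of_orthonormal (V := TangentSpace I x) hE (S.unit_ξ x) (hX.unit x hx) (hX.inner_φ_φ hx)
    (hX.orth x hx) (S.inner_ξ_φ _) (S.inner_self_φ _) v

variable (S)

/-- Normalizing a vector field which is not zero at `x` gives an adapted one near `x`. -/
lemma exists_isAdapted_of_field (hT : SmoothField U T) (hx : x ∈ U)
    (hT0 : inner ℝ (T x) (T x) ≠ (0 : ℝ)) (hTξ : ∀ y ∈ U, inner ℝ (S.ξ y) (T y) = (0 : ℝ)) :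
    ∃ V ≤ U, x ∈ V ∧ ∃ f, SmoothFun I V f ∧ (∀ y ∈ V, f y ≠ 0) ∧ S.IsAdapted V (f • T) := by
  have hs := smoothFun_inner hT hT
  have hev : ∀ᶠ y in nhds x, 0 < (inner ℝ (T y) (T y) : ℝ) :=
    (hs x hx).continuousAt.eventually_const_lt
      (lt_of_le_of_ne (real_inner_self_nonneg) hT0.symm)
  obtain ⟨W, hW, hWo, hxW⟩ := eventually_nhds_iff.1 hev
  let V : TopologicalSpace.Opens M := ⟨W, hWo⟩ ⊓ U
  have hVU : V ≤ U := inf_le_right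
  have hpos : ∀ y ∈ V, 0 < (inner ℝ (T y) (T y) : ℝ) := fun y hy ↦ hW y hy.1
  have hf := ((hs.mono hVU).sqrt hpos).inv fun y hy ↦ (Real.sqrt_pos.2 (hpos y hy)).ne'
  refine ⟨V, hVU, ⟨hxW, hx⟩, _, hf, fun y hy ↦ (inv_pos.2 (Real.sqrt_pos.2 (hpos y hy))).ne',
    (hT.mono hVU).smul hf, fun y hy ↦ ?_, fun y hy ↦ ?_⟩
  · have h1 := Real.mul_self_sqrt (hpos y hy).le
    have h2 := (Real.sqrt_pos.2 (hpos y hy)).ne'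
    simp only [Pi.smul_apply', real_inner_smul_left, real_inner_smul_right]
    field_simp
    rw [sq, h1]
  · simp [real_inner_smul_right, hTξ y (hVU hy)]

lemma exists_smoothField_extend (v : TangentSpace I x) :
    ∃ U : TopologicalSpace.Opens M, x ∈ U ∧
      SmoothField U (extend E v : Π x : M, TangentSpace I x) := by
  obtain ⟨s, hs, h⟩ := exists_contMDiffOn_extend (V := fun x : M ↦ TangentSpace I x) (k := ∞) I E v
  obtain ⟨W, hW, hWo, hxW⟩ := mem_nhds_iff.1 hs
  exact ⟨⟨W, hWo⟩, hxW, fun y hy ↦ h.contMDiffAt (Filter.mem_of_superset (hWo.mem_nhds hy) hW)⟩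

lemma exists_smoothField (v : TangentSpace I x) :
    ∃ U : TopologicalSpace.Opens M, x ∈ U ∧ ∃ X : Π x : M, TangentSpace I x,
      SmoothField U X ∧ X x = v := by
  obtain ⟨U, hx, h⟩ := exists_smoothField_extend v
  exact ⟨U, hx, _, h, extend_apply_self (F := E) v⟩

lemma cov_ξ_ξ : cov S.ξ S.ξ x = 0 := by
  refine ext_inner_right ℝ fun w ↦ ?_
  obtain ⟨U, hx, Y, hY, rfl⟩ := exists_smoothField w
  have h := S.inner_cov_ξ_sub S.smoothField_ξ hY hx
  rw [S.inner_cov_ξ_ξ hY hx, S.inner_ξ_φ] at h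
  rw [inner_zero_left]
  linarith

lemma exists_isAdapted (hE : Module.finrank ℝ E = 3) (x : M) :
    ∃ U : TopologicalSpace.Opens M, x ∈ U ∧ ∃ X, S.IsAdapted U X := by
  obtain ⟨v, hv⟩ : ∃ v : TangentSpace I x, v ∉ Submodule.span ℝ {S.ξ x} := by
    by_contra! h
    have h1 : Module.finrank ℝ (TangentSpace I x) ≤ 1 :=
      finrank_le_one (S.ξ x) fun w ↦ Submodule.mem_span_singleton.1 (h w)
    have h2 : Module.finrank ℝ (TangentSpace I x) = 3 := hE
    omega
  obtain ⟨U, hx, Y, hY, rfl⟩ := exists_smoothField v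
  have hT : SmoothField U (Y - (fun y ↦ (inner ℝ (S.ξ y) (Y y) : ℝ)) • S.ξ) :=
    hY.sub (S.smoothField_ξ.smul (smoothFun_inner S.smoothField_ξ hY))
  have h0 : (Y - (fun y ↦ (inner ℝ (S.ξ y) (Y y) : ℝ)) • S.ξ) x ≠ 0 := fun h ↦ hv <| by
    simp only [Pi.sub_apply, Pi.smul_apply', sub_eq_zero] at h
    rw [h]
    exact Submodule.smul_mem _ _ (Submodule.mem_span_singleton_self _)
  obtain ⟨V, -, hxV, f, -, -, hf⟩ := S.exists_isAdapted_of_field hT hx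
    (fun h ↦ h0 (inner_self_eq_zero.1 h))
    (fun y _ ↦ by
      simp only [Pi.sub_apply, Pi.smul_apply', inner_sub_right, real_inner_smul_right, S.unit_ξ]
      ring)
  exact ⟨V, hxV, _, hf⟩

/-- A vector field with smooth inner products is smooth. -/
lemma smoothField_of_inner (S : ContactMetricStructure I M) (hE : Module.finrank ℝ E = 3)
    (hT : ∀ V ≤ U, ∀ Y : Π x : M, TangentSpace I x, SmoothField V Y →
      SmoothFun I V (fun x ↦ inner ℝ (T x) (Y x))) : SmoothField U T := by
  intro x hx
  obtain ⟨W, hxW, X, hX⟩ := S.exists_isAdapted hE x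
  replace hX := hX.mono (V := W ⊓ U) inf_le_left
  have h : ∀ {Y : Π x : M, TangentSpace I x}, SmoothField (W ⊓ U) Y → _ :=
    fun hY ↦ hT (W ⊓ U) inf_le_right _ hY
  have := ((S.smoothField_ξ.smul (h S.smoothField_ξ)).add (hX.smooth.smul (h hX.smooth))).add
    ((hX.smooth.endo S).smul (h (hX.smooth.endo S)))
  refine (this.congr fun y hy ↦ ?_) x ⟨hxW, hx⟩
  exact hX.eq_sum hE hy (T y)

lemma smoothFun_dirDeriv (S : ContactMetricStructure I M) (hX : SmoothField U X)
    (hf : SmoothFun I U f) :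
    SmoothFun I U (dirDeriv X f) :=
  KappaSpace.smoothFun_dirDeriv S.smoothField_ξ (fun y _ ↦ S.unit_ξ y) hX hf

lemma dirDeriv_lieBracket (S : ContactMetricStructure I M) (hX : SmoothField U X)
    (hY : SmoothField U Y) (hf : SmoothFun I U f)
    (hx : x ∈ U) : dirDeriv (mlieBracket I X Y) f x =
      dirDeriv X (dirDeriv Y f) x - dirDeriv Y (dirDeriv X f) x :=
  KappaSpace.dirDeriv_lieBracket S.smoothField_ξ (fun y _ ↦ S.unit_ξ y) hX hY hf hx

lemma smoothField_cov (S : ContactMetricStructure I M) (hE : Module.finrank ℝ E = 3)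
    (hX : SmoothField U X)
    (hY : SmoothField U Y) : SmoothField U (cov X Y) := by
  have : CompleteSpace E := FiniteDimensional.complete ℝ E
  refine S.smoothField_of_inner hE fun V hV Z hZ ↦ ?_
  replace hX := hX.mono hV
  replace hY := hY.mono hV
  have a := S.smoothFun_dirDeriv hX (smoothFun_inner hY hZ)
  have b := S.smoothFun_dirDeriv hY (smoothFun_inner hX hZ)
  have c := S.smoothFun_dirDeriv hZ (smoothFun_inner hX hY)
  have d := smoothFun_inner (hX.lieBracket hY) hZ
  have e := smoothFun_inner (hX.lieBracket hZ) hY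
  have f := smoothFun_inner (hY.lieBracket hZ) hX
  refine ((SmoothFun.const (1 / 2)).mul (((((a.add b).sub c).add d).sub e).sub f)).congr
    fun y hy ↦ ?_
  have := two_mul_inner_cov hX hY hZ hy
  simp only [koszul] at this
  simp only [dirDeriv]
  linarith

end ContactMetricStructure

end ContactMetric

section Killing

set_option linter.unusedSectionVars false

variable {E : Type*} [NormedAddCommGroup E] [NormedSpace ℝ E] [FiniteDimensional ℝ E]
  {H : Type*} [TopologicalSpace H] {I : ModelWithCorners ℝ E H}
  {M : Type*} [TopologicalSpace M] [ChartedSpace H M]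
  [RiemannianBundle (fun x : M ↦ TangentSpace I x)]
  [IsManifold I ∞ M] [IsContMDiffRiemannianBundle I ∞ E (fun x : M ↦ TangentSpace I x)]
  {U V : TopologicalSpace.Opens M} {f g : M → ℝ} {x : M}
  {X Y Z T : Π x : M, TangentSpace I x}

lemma lieBracket_add_right (hX : SmoothField U X) (hY : SmoothField U Y) (hx : x ∈ U) :
    mlieBracket I Z (X + Y) x = mlieBracket I Z X x + mlieBracket I Z Y x := by
  have : CompleteSpace E := FiniteDimensional.complete ℝ E
  exact mlieBracket_add_right (hX.mdiffAt hx) (hY.mdiffAt hx)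

lemma lieBracket_sub_right (hX : SmoothField U X) (hY : SmoothField U Y) (hx : x ∈ U) :
    mlieBracket I Z (X - Y) x = mlieBracket I Z X x - mlieBracket I Z Y x := by
  have h := lieBracket_add_right (Z := Z) (hX.sub hY) hY hx
  rw [sub_add_cancel] at h
  rw [h, add_sub_cancel_right]

/-- A smooth vector field with `L_Z g = 0`, tested on vector fields defined on open sets. -/
structure IsKilling (Z : Π x : M, TangentSpace I x) : Prop where
  smooth : ∀ U : TopologicalSpace.Opens M, SmoothField U Z
  lieDeriv_inner : ∀ {U : TopologicalSpace.Opens M} {X Y : Π x : M, TangentSpace I x} {x : M},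
    SmoothField U X → SmoothField U Y → x ∈ U → dirDeriv Z (fun y ↦ inner ℝ (X y) (Y y)) x =
      inner ℝ (mlieBracket I Z X x) (Y x) + inner ℝ (X x) (mlieBracket I Z Y x)

lemma IsInfinitesimalIsometry.isKilling (hZ : IsInfinitesimalIsometry I Z) : IsKilling Z where
  smooth U x _ := hZ.smooth x
  lieDeriv_inner {U X Y x} hX hY hx := by
    have := hZ.lieDeriv_metric x X Y (hX x hx) (hY x hx)
    rw [lieDerivMetric] at this
    rw [dirDeriv]
    linarith

/-- For a Killing field, `∇Z` is skew-symmetric. -/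
lemma IsKilling.inner_cov (hZ : IsKilling Z) (hX : SmoothField U X) (hY : SmoothField U Y)
    (hx : x ∈ U) : inner ℝ (cov X Z x) (Y x) = -inner ℝ (X x) (cov Y Z x) := by
  have h1 := hZ.lieDeriv_inner hX hY hx
  rw [dirDeriv_inner (hZ.smooth U) hX hY hx, ← cov_sub_cov (hZ.smooth U) hX hx,
    ← cov_sub_cov (hZ.smooth U) hY hx, inner_sub_left, inner_sub_right] at h1
  linarith

namespace ContactMetricStructure

variable (S : ContactMetricStructure I M)

/-- A Killing field preserves the Levi-Civita connection. -/
lemma lieBracket_cov (S : ContactMetricStructure I M) (hE : Module.finrank ℝ E = 3)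
    (hZ : IsKilling Z) (hX : SmoothField U X)
    (hY : SmoothField U Y) (hx : x ∈ U) : mlieBracket I Z (cov X Y) x =
      cov (mlieBracket I Z X) Y x + cov X (mlieBracket I Z Y) x := by
  have : CompleteSpace E := FiniteDimensional.complete ℝ E
  let T (X Y : Π x : M, TangentSpace I x) : TangentSpace I x :=
    mlieBracket I Z (cov X Y) x - cov (mlieBracket I Z X) Y x - cov X (mlieBracket I Z Y) x
  suffices h : T X Y = 0 by
    simp only [T, sub_sub, sub_eq_zero] at h
    exact h
  refine ext_inner_right ℝ fun w ↦ ?_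
  rw [inner_zero_left]
  obtain ⟨V, hxV, W, hW, rfl⟩ := exists_smoothField w
  replace hX := hX.mono (V := U ⊓ V) inf_le_left
  replace hY := hY.mono (V := U ⊓ V) inf_le_left
  replace hW := hW.mono (V := U ⊓ V) inf_le_right
  replace hx : x ∈ U ⊓ V := ⟨hx, hxV⟩
  have hZ' := hZ.smooth (U ⊓ V)
  have symm : ∀ {X Y : Π x : M, TangentSpace I x}, SmoothField (U ⊓ V) X →
      SmoothField (U ⊓ V) Y → T X Y = T Y X := by
    intro X Y hX hY
    have h1 := jacobi hZ' hX hY hx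
    rw [← lieBracket_congr (X := Z) (fun _ _ ↦ rfl) (fun y hy ↦ cov_sub_cov hX hY hy) hx] at h1
    have h2 := lieBracket_sub_right (Z := Z) (S.smoothField_cov hE hX hY)
      (S.smoothField_cov hE hY hX) hx
    have h3 := cov_sub_cov (hZ'.lieBracket hX) hY hx
    have h4 := cov_sub_cov hX (hZ'.lieBracket hY) hx
    have h5 : mlieBracket I Z (cov X Y) x - mlieBracket I Z (cov Y X) x = _ := h2.symm.trans h1
    rw [← h3, ← h4] at h5
    simp only [T]
    rw [← sub_eq_zero] at h5 ⊢
    rw [← h5]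
    abel
  have skew : ∀ {Y W : Π x : M, TangentSpace I x}, ∀ {X : Π x : M, TangentSpace I x},
      SmoothField (U ⊓ V) X → SmoothField (U ⊓ V) Y → SmoothField (U ⊓ V) W →
      inner ℝ (T X Y) (W x) = -inner ℝ (T X W) (Y x) := by
    intro Y W X hX hY hW
    have h1 := hZ.lieDeriv_inner (S.smoothField_cov hE hX hY) hW hx
    have h2 := hZ.lieDeriv_inner hY (S.smoothField_cov hE hX hW) hx
    have h3 := dirDeriv_inner (hZ'.lieBracket hX) hY hW hx
    have h4 := dirDeriv_inner hX (hZ'.lieBracket hY) hW hx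
    have h5 := dirDeriv_inner hX hY (hZ'.lieBracket hW) hx
    have h6 := S.dirDeriv_lieBracket hZ' hX (smoothFun_inner hY hW) hx
    have h7 : dirDeriv Z (dirDeriv X fun y ↦ inner ℝ (Y y) (W y)) x = _ :=
      dirDeriv_congr (fun y hy ↦ dirDeriv_inner hX hY hW hy) hx
    have h8 : dirDeriv X (dirDeriv Z fun y ↦ inner ℝ (Y y) (W y)) x = _ :=
      dirDeriv_congr (fun y hy ↦ hZ.lieDeriv_inner hY hW hy) hx
    rw [dirDeriv_add (smoothFun_inner (S.smoothField_cov hE hX hY) hW)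
      (smoothFun_inner hY (S.smoothField_cov hE hX hW)) hx] at h7
    rw [dirDeriv_add (smoothFun_inner (hZ'.lieBracket hY) hW)
      (smoothFun_inner hY (hZ'.lieBracket hW)) hx] at h8
    simp only [T, inner_sub_left, inner_sub_right, real_inner_comm (Y x)]
    linarith
  have h1 := skew hX hY hW
  have h2 := skew hW hX hY
  have h3 := skew hY hW hX
  rw [symm hX hW] at h1
  rw [symm hW hY] at h2
  rw [symm hY hX] at h3
  linarith

lemma curvature_eq : curvature I X Y T x =
    cov X (cov Y T) x - cov Y (cov X T) x - cov (mlieBracket I X Y) T x := rfl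

/-- A Killing field preserves the curvature tensor. -/
lemma lieBracket_curvature (S : ContactMetricStructure I M) (hE : Module.finrank ℝ E = 3)
    (hZ : IsKilling Z)
    (hX : SmoothField U X) (hY : SmoothField U Y) (hT : SmoothField U T) (hx : x ∈ U) :
    mlieBracket I Z (curvature I X Y T) x = curvature I (mlieBracket I Z X) Y T x +
      curvature I X (mlieBracket I Z Y) T x + curvature I X Y (mlieBracket I Z T) x := by
  have : CompleteSpace E := FiniteDimensional.complete ℝ E
  have hZ' := hZ.smooth U
  have c : ∀ {X Y : Π x : M, TangentSpace I x}, SmoothField U X → SmoothField U Y →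
      SmoothField U (cov X Y) := S.smoothField_cov hE
  have second : ∀ {X Y : Π x : M, TangentSpace I x}, SmoothField U X → SmoothField U Y →
      mlieBracket I Z (cov X (cov Y T)) x = cov (mlieBracket I Z X) (cov Y T) x
        + cov X (cov (mlieBracket I Z Y) T) x + cov X (cov Y (mlieBracket I Z T)) x := by
    intro X Y hX hY
    rw [S.lieBracket_cov hE hZ hX (c hY hT) hx, add_assoc,
      ← cov_add_right (c (hZ'.lieBracket hY) hT) (c hY (hZ'.lieBracket hT)) hx,
      cov_congr_right (hZ'.lieBracket (c hY hT))
        (fun y hy ↦ S.lieBracket_cov hE hZ hY hT hy) hx]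
    rfl
  have h1 : mlieBracket I Z (curvature I X Y T) x =
      mlieBracket I Z (cov X (cov Y T) - cov Y (cov X T)) x -
        mlieBracket I Z (cov (mlieBracket I X Y) T) x :=
    lieBracket_sub_right ((c hX (c hY hT)).sub (c hY (c hX hT))) (c (hX.lieBracket hY) hT) hx
  have h2 := jacobi hZ' hX hY hx
  have h3 : cov (mlieBracket I Z (mlieBracket I X Y)) T x =
      cov (mlieBracket I (mlieBracket I Z X) Y) T x +
        cov (mlieBracket I X (mlieBracket I Z Y)) T x := by
    simp only [cov, h2, map_add]
  rw [h1, lieBracket_sub_right (c hX (c hY hT)) (c hY (c hX hT)) hx, second hX hY, second hY hX,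
    S.lieBracket_cov hE hZ (hX.lieBracket hY) hT hx, h3]
  simp only [curvature_eq]
  abel

/-- The curvature `R(X, Y)` is skew-symmetric. -/
lemma inner_curvature_skew (S : ContactMetricStructure I M) (hE : Module.finrank ℝ E = 3)
    (hX : SmoothField U X)
    (hY : SmoothField U Y) (hZ : SmoothField U Z) (hT : SmoothField U T) (hx : x ∈ U) :
    inner ℝ (curvature I X Y Z x) (T x) = -inner ℝ (curvature I X Y T x) (Z x) := by
  have : CompleteSpace E := FiniteDimensional.complete ℝ E
  have c : ∀ {X Y : Π x : M, TangentSpace I x}, SmoothField U X → SmoothField U Y →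
      SmoothField U (cov X Y) := S.smoothField_cov hE
  have second : ∀ {X Y : Π x : M, TangentSpace I x}, SmoothField U X → SmoothField U Y →
      dirDeriv X (dirDeriv Y fun y ↦ inner ℝ (Z y) (T y)) x =
        inner ℝ (cov X (cov Y Z) x) (T x) + inner ℝ (cov Y Z x) (cov X T x) +
        (inner ℝ (cov X Z x) (cov Y T x) + inner ℝ (Z x) (cov X (cov Y T) x)) := by
    intro X Y hX hY
    have h : dirDeriv X (dirDeriv Y fun y ↦ inner ℝ (Z y) (T y)) x = _ :=
      dirDeriv_congr (fun y hy ↦ dirDeriv_inner hY hZ hT hy) hx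
    rw [h, dirDeriv_add (smoothFun_inner (c hY hZ) hT) (smoothFun_inner hZ (c hY hT)) hx,
      dirDeriv_inner hX (c hY hZ) hT hx, dirDeriv_inner hX hZ (c hY hT) hx]
  have h1 := S.dirDeriv_lieBracket hX hY (smoothFun_inner hZ hT) hx
  rw [second hX hY, second hY hX, dirDeriv_inner (hX.lieBracket hY) hZ hT hx] at h1
  simp only [curvature_eq, inner_sub_left, inner_sub_right, real_inner_comm (Z x)]
  linarith

lemma eq_zero_of_inner (hE : Module.finrank ℝ E = 3) {w u : TangentSpace I x} (hw : w ≠ 0)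
    (hξw : inner ℝ (S.ξ x) w = (0 : ℝ)) (h0 : inner ℝ u (S.ξ x) = (0 : ℝ))
    (h1 : inner ℝ u w = (0 : ℝ)) (h2 : inner ℝ u (S.φ x w) = (0 : ℝ)) : u = 0 := by
  have hr : ‖w‖ ≠ 0 := norm_ne_zero_iff.2 hw
  have hww : inner ℝ w w = ‖w‖ * ‖w‖ := real_inner_self_eq_norm_mul_norm w
  have := eq_sum_of_orthonormal (V := TangentSpace I x) hE (a := S.ξ x) (b := ‖w‖⁻¹ • w)
    (c := ‖w‖⁻¹ • S.φ x w) (S.unit_ξ x)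
    (by rw [real_inner_smul_left, real_inner_smul_right, hww]; field_simp)
    (by rw [real_inner_smul_left, real_inner_smul_right, S.inner_φ_φ, hξw, hww]; field_simp; simp)
    (by rw [real_inner_smul_right, hξw, mul_zero])
    (by rw [real_inner_smul_right, S.inner_ξ_φ, mul_zero])
    (by rw [real_inner_smul_right, real_inner_smul_left, S.inner_self_φ, mul_zero, mul_zero]) u
  rw [this, h0, real_inner_smul_right, real_inner_smul_right, h1, h2]
  simp

/-- The curvature condition `R(X, Y) ξ = c (η(Y) X - η(X) Y)` on an open set, `c` a constant. -/
def HasConstCurvatureAlong (c : ℝ) (T : Π x : M, TangentSpace I x) : Prop :=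
  ∀ {U : TopologicalSpace.Opens M} {X Y : Π x : M, TangentSpace I x} {x : M},
    SmoothField U X → SmoothField U Y → x ∈ U → curvature I X Y T x =
      c • ((inner ℝ (T x) (Y x) : ℝ) • X x - (inner ℝ (T x) (X x) : ℝ) • Y x)

variable {c : ℝ}

lemma inner_ξ_lieBracket (hZ : IsKilling Z) :
    inner ℝ (S.ξ x) (mlieBracket I Z S.ξ x) = (0 : ℝ) := by
  have h := hZ.lieDeriv_inner (U := ⊤) S.smoothField_ξ S.smoothField_ξ (x := x) trivial
  rw [dirDeriv_eq_zero_of_const (U := ⊤) (fun y _ ↦ S.unit_ξ y) trivial,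
    real_inner_comm (S.ξ x)] at h
  linarith

lemma hasConstCurvatureAlong_lieBracket (hE : Module.finrank ℝ E = 3) (hZ : IsKilling Z)
    (h : HasConstCurvatureAlong c S.ξ) : HasConstCurvatureAlong c (mlieBracket I Z S.ξ) := by
  intro U X Y x hX hY hx
  have : CompleteSpace E := FiniteDimensional.complete ℝ E
  have hZ' := hZ.smooth U
  have hξ := S.smoothField_ξ (U := U)
  have h1 := S.lieBracket_curvature hE hZ hX hY hξ hx
  have sm : ∀ {Y : Π x : M, TangentSpace I x}, SmoothField U Y →
      SmoothFun I U (fun y ↦ c * inner ℝ (S.ξ y) (Y y)) := fun hY ↦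
    (SmoothFun.const c).mul (smoothFun_inner hξ hY)
  have e : ∀ y ∈ U, curvature I X Y S.ξ y = ((fun y ↦ c * inner ℝ (S.ξ y) (Y y)) • X
      - (fun y ↦ c * inner ℝ (S.ξ y) (X y)) • Y) y := by
    intro y hy
    rw [h hX hY hy]
    simp only [Pi.sub_apply, Pi.smul_apply']
    module
  have d : ∀ {Y : Π x : M, TangentSpace I x}, SmoothField U Y →
      dirDeriv Z (fun y ↦ c * inner ℝ (S.ξ y) (Y y)) x =
        c * (inner ℝ (mlieBracket I Z S.ξ x) (Y x) + inner ℝ (S.ξ x) (mlieBracket I Z Y x)) := by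
    intro Y hY
    rw [dirDeriv_mul (SmoothFun.const c) (smoothFun_inner hξ hY) hx, dirDeriv_const,
      hZ.lieDeriv_inner hξ hY hx]
    ring
  rw [lieBracket_congr (fun _ _ ↦ rfl) e hx,
    lieBracket_sub_right (hX.smul (sm hY)) (hY.smul (sm hX)) hx,
    lieBracket_smul_right (sm hY) hX hx, lieBracket_smul_right (sm hX) hY hx, d hX, d hY,
    h (hZ'.lieBracket hX) hY hx, h hX (hZ'.lieBracket hY) hx] at h1
  rw [← sub_eq_iff_eq_add'] at h1
  rw [← h1]
  module

/-- If the curvature is that of a space form along `ξ` and along `W`, it is so altogether at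
points where `W` is not zero. -/
lemma hasConstCurvature_of_ne_zero (hE : Module.finrank ℝ E = 3) {W : Π x : M, TangentSpace I x}
    (h : HasConstCurvatureAlong c S.ξ) (hW : HasConstCurvatureAlong c W) (hWU : SmoothField U W)
    (hξW : ∀ x ∈ U, inner ℝ (S.ξ x) (W x) = (0 : ℝ)) (hX : SmoothField U X)
    (hY : SmoothField U Y) (hT : SmoothField U T) (hx : x ∈ U) (hWx : W x ≠ 0) :
    curvature I X Y T x =
      c • ((inner ℝ (T x) (Y x) : ℝ) • X x - (inner ℝ (T x) (X x) : ℝ) • Y x) := by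
  have hξ := S.smoothField_ξ (U := U)
  let D (T : Π x : M, TangentSpace I x) : TangentSpace I x := curvature I X Y T x -
    c • ((inner ℝ (T x) (Y x) : ℝ) • X x - (inner ℝ (T x) (X x) : ℝ) • Y x)
  have skew : ∀ {T T' : Π x : M, TangentSpace I x}, SmoothField U T → SmoothField U T' →
      inner ℝ (D T) (T' x) = -inner ℝ (D T') (T x) := by
    intro T T' hT hT'
    have := S.inner_curvature_skew hE hX hY hT hT' hx
    simp only [D, inner_sub_left, real_inner_smul_left, this, real_inner_comm (X x),
      real_inner_comm (Y x)]
    ring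
  have hDξ : D S.ξ = 0 := sub_eq_zero.2 (h hX hY hx)
  have hDW : D W = 0 := sub_eq_zero.2 (hW hX hY hx)
  have hN := hWU.endo S
  have hDN : D (S.endo W) = 0 := by
    refine S.eq_zero_of_inner hE hWx (hξW x hx) ?_ ?_ ?_
    · rw [skew hN hξ, hDξ, inner_zero_left, neg_zero]
    · rw [skew hN hWU, hDW, inner_zero_left, neg_zero]
    · have := skew hN hN
      rw [S.endo_apply] at this
      linarith
  refine sub_eq_zero.1 (S.eq_zero_of_inner hE hWx (hξW x hx) (u := D T) ?_ ?_ ?_)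
  · rw [skew hT hξ, hDξ, inner_zero_left, neg_zero]
  · rw [skew hT hWU, hDW, inner_zero_left, neg_zero]
  · rw [← S.endo_apply, skew hT hN, hDN, inner_zero_left, neg_zero]

lemma scalarCurvature_eq (hE : Module.finrank ℝ E = 3) {W : Π x : M, TangentSpace I x}
    (h : HasConstCurvatureAlong c S.ξ) (hW : HasConstCurvatureAlong c W)
    (hWU : ∀ U, SmoothField U W)
    (hξW : ∀ x, inner ℝ (S.ξ x) (W x) = (0 : ℝ)) (hWx : W x ≠ 0) :
    scalarCurvature I x = 6 * c := by
  have key : ∀ u v w : TangentSpace I x,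
      curvatureAt I x u v w = c • ((inner ℝ w v : ℝ) • u - (inner ℝ w u : ℝ) • v) := by
    intro u v w
    obtain ⟨U₁, h₁, hu⟩ := exists_smoothField_extend u
    obtain ⟨U₂, h₂, hv⟩ := exists_smoothField_extend v
    obtain ⟨U₃, h₃, hw⟩ := exists_smoothField_extend w
    have := S.hasConstCurvature_of_ne_zero hE h hW (hWU (U₁ ⊓ U₂ ⊓ U₃)) (fun y _ ↦ hξW y)
      (hu.mono (inf_le_left.trans inf_le_left)) (hv.mono (inf_le_left.trans inf_le_right))
      (hw.mono inf_le_right) ⟨⟨h₁, h₂⟩, h₃⟩ hWx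
    simpa [curvatureAt] using this
  have h3 : Module.finrank ℝ (TangentSpace I x) = 3 := hE
  simp only [scalarCurvature, ricci, key, inner_sub_left, real_inner_smul_left,
    OrthonormalBasis.inner_eq_ite]
  simp [Finset.sum_sub_distrib, h3, ← Finset.mul_sum]
  ring

end ContactMetricStructure

end Killing

section Frame

set_option linter.unusedSectionVars false

variable {E : Type*} [NormedAddCommGroup E] [NormedSpace ℝ E] [FiniteDimensional ℝ E]
  {H : Type*} [TopologicalSpace H] {I : ModelWithCorners ℝ E H}
  {M : Type*} [TopologicalSpace M] [ChartedSpace H M]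
  [RiemannianBundle (fun x : M ↦ TangentSpace I x)]
  [IsManifold I ∞ M] [IsContMDiffRiemannianBundle I ∞ E (fun x : M ↦ TangentSpace I x)]
  {U V : TopologicalSpace.Opens M} {f g κ : M → ℝ} {x : M}
  {X Y Z T W : Π x : M, TangentSpace I x}

lemma cov_smul_add_smul {v : Π x : M, TangentSpace I x} {a b : ℝ}
    (h : v x = a • X x + b • Y x) : cov v T x = a • cov X T x + b • cov Y T x := by
  simp only [cov, h, map_add, map_smul]

lemma cov_smul_left {v : Π x : M, TangentSpace I x} {a : ℝ}
    (h : v x = a • X x) : cov v T x = a • cov X T x := by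
  simp only [cov, h, map_smul]

lemma cov_eq_zero_of_eq_zero (h : ∀ y ∈ U, T y = 0) (hx : x ∈ U) : cov X T x = 0 := by
  have h0 : SmoothField U (0 : Π x : M, TangentSpace I x) := fun x _ ↦
    contMDiffAt_zeroSection ℝ (TangentSpace I)
  rw [← cov_congr_right h0 (fun y hy ↦ (h y hy).symm) hx]
  simp [cov]

/-- Lie brackets of Killing fields are Killing fields. -/
lemma IsKilling.lieBracket (S : ContactMetricStructure I M) (hZ : IsKilling Z) (hW : IsKilling W) :
    IsKilling (mlieBracket I Z W) where
  smooth U := by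
    have : CompleteSpace E := FiniteDimensional.complete ℝ E
    exact (hZ.smooth U).lieBracket (hW.smooth U)
  lieDeriv_inner {U X Y x} hX hY hx := by
    have : CompleteSpace E := FiniteDimensional.complete ℝ E
    have second : ∀ {Z W : Π x : M, TangentSpace I x}, IsKilling Z → IsKilling W →
        dirDeriv Z (dirDeriv W fun y ↦ inner ℝ (X y) (Y y)) x =
        inner ℝ (mlieBracket I Z (mlieBracket I W X) x) (Y x) +
          inner ℝ (mlieBracket I W X x) (mlieBracket I Z Y x) +
        (inner ℝ (mlieBracket I Z X x) (mlieBracket I W Y x) +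
          inner ℝ (X x) (mlieBracket I Z (mlieBracket I W Y) x)) := by
      intro Z W hZ hW
      have hWX := (hW.smooth U).lieBracket hX
      have hWY := (hW.smooth U).lieBracket hY
      have h : dirDeriv Z (dirDeriv W fun y ↦ inner ℝ (X y) (Y y)) x = _ :=
        dirDeriv_congr (fun y hy ↦ hW.lieDeriv_inner hX hY hy) hx
      rw [h, dirDeriv_add (smoothFun_inner hWX hY) (smoothFun_inner hX hWY) hx,
        hZ.lieDeriv_inner hWX hY hx, hZ.lieDeriv_inner hX hWY hx]
    rw [S.dirDeriv_lieBracket (hZ.smooth U) (hW.smooth U) (smoothFun_inner hX hY) hx,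
      second hZ hW, second hW hZ, jacobi (hZ.smooth U) (hW.smooth U) hX hx,
      jacobi (hZ.smooth U) (hW.smooth U) hY hx, inner_add_left, inner_add_right]
    ring

namespace ContactMetricStructure

variable (S : ContactMetricStructure I M)

lemma inner_self_endo : inner ℝ (X x) (S.endo X x) = (0 : ℝ) := S.inner_self_φ _

lemma inner_cov_cov (S : ContactMetricStructure I M) (hE : Module.finrank ℝ E = 3)
    (hX : SmoothField U X) (hY : SmoothField U Y) (hZ : SmoothField U Z) (hT : SmoothField U T)
    (hx : x ∈ U) : inner ℝ (cov X (cov Y Z) x) (T x) =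
      dirDeriv X (fun y ↦ inner ℝ (cov Y Z y) (T y)) x - inner ℝ (cov Y Z x) (cov X T x) := by
  rw [dirDeriv_inner hX (S.smoothField_cov hE hY hZ) hT hx]
  ring

lemma inner_curvature_ξ (hE : Module.finrank ℝ E = 3) (hX : SmoothField U X)
    (hT : SmoothField U T) (hx : x ∈ U) : inner ℝ (curvature I X S.ξ S.ξ x) (T x) =
      inner ℝ (cov X S.ξ x) (cov S.ξ T x) - dirDeriv S.ξ (fun y ↦ inner ℝ (cov X S.ξ y) (T y)) x
        - inner ℝ (cov (cov X S.ξ) S.ξ x) (T x) + inner ℝ (cov (cov S.ξ X) S.ξ x) (T x) := by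
  have hξ := S.smoothField_ξ (U := U)
  have h1 : cov (mlieBracket I X S.ξ) S.ξ x = cov (cov X S.ξ) S.ξ x - cov (cov S.ξ X) S.ξ x := by
    simp only [cov, ← cov_sub_cov hX hξ hx, map_sub]
  rw [curvature_eq, h1, cov_eq_zero_of_eq_zero (fun y _ ↦ S.cov_ξ_ξ) hx, inner_sub_left,
    inner_sub_left, inner_zero_left, S.inner_cov_cov hE hξ hX hξ hT hx, inner_sub_left]
  ring

/-- The condition `R(X, Y) ξ = κ (η(Y) X - η(X) Y)`, tested on open sets. -/
def IsKappa (κ : M → ℝ) : Prop :=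
  ∀ {U : TopologicalSpace.Opens M} {X Y : Π x : M, TangentSpace I x} {x : M},
    SmoothField U X → SmoothField U Y → x ∈ U → curvature I X Y S.ξ x =
      κ x • ((inner ℝ (S.ξ x) (Y x) : ℝ) • X x - (inner ℝ (S.ξ x) (X x) : ℝ) • Y x)

variable {S}

lemma IsKappaSpace.isKappa (h : S.IsKappaSpace κ) : S.IsKappa κ := by
  intro U X Y x hX hY hx
  rw [h.curvature_ξ x X Y (hX x hx) (hY x hx), S.η_apply, S.η_apply]

lemma IsKappa.curvature_ξ (h : S.IsKappa κ) (hX : SmoothField U X)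
    (hXξ : inner ℝ (S.ξ x) (X x) = (0 : ℝ)) (hx : x ∈ U) :
    curvature I X S.ξ S.ξ x = κ x • X x := by
  rw [h hX S.smoothField_ξ hx, S.unit_ξ, hXξ]
  simp

namespace IsAdapted

lemma cov_ξ_eq (hX : S.IsAdapted U X) (hE : Module.finrank ℝ E = 3) (hT : SmoothField U T)
    (hx : x ∈ U) : cov T S.ξ x = (inner ℝ (cov T S.ξ x) (X x) : ℝ) • X x +
      (inner ℝ (cov T S.ξ x) (S.endo X x) : ℝ) • S.endo X x := by
  have := hX.eq_sum hE hx (cov T S.ξ x)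
  rwa [S.inner_cov_ξ_ξ hT hx, zero_smul, zero_add] at this

lemma inner_cov_self (hX : S.IsAdapted U X) (hT : SmoothField U T) (hx : x ∈ U) :
    inner ℝ (cov T X x) (X x) = (0 : ℝ) := by
  have h := dirDeriv_inner hT hX.smooth hX.smooth hx
  rw [dirDeriv_eq_zero_of_const hX.unit hx, real_inner_comm (cov T X x)] at h
  linarith

lemma endo (hX : S.IsAdapted U X) : S.IsAdapted U (S.endo X) where
  smooth := hX.smooth.endo S
  unit _ hx := hX.inner_φ_φ hx
  orth _ _ := S.inner_ξ_φ _

lemma endo_endo (hX : S.IsAdapted U X) (hx : x ∈ U) : S.endo (S.endo X) x = -X x := hX.φ_φ hx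

lemma inner_cov_ξ (hX : S.IsAdapted U X) (hT : SmoothField U T) (hx : x ∈ U) :
    inner ℝ (cov T X x) (S.ξ x) = -inner ℝ (cov T S.ξ x) (X x) := by
  have h := dirDeriv_inner hT hX.smooth S.smoothField_ξ hx
  rw [dirDeriv_eq_zero_of_const (fun y hy ↦ hX.orth' hy) hx, real_inner_comm (cov T S.ξ x)] at h
  linarith

lemma inner_cov_endo (hX : S.IsAdapted U X) (hT : SmoothField U T) (hx : x ∈ U) :
    inner ℝ (cov T (S.endo X) x) (X x) = -inner ℝ (cov T X x) (S.endo X x) := by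
  have h := dirDeriv_inner hT hX.smooth hX.endo.smooth hx
  rw [dirDeriv_eq_zero_of_const (fun y hy ↦ S.inner_self_endo) hx,
    real_inner_comm (cov T (S.endo X) x)] at h
  linarith

lemma cov_eq (hX : S.IsAdapted U X) (hE : Module.finrank ℝ E = 3) (hT : SmoothField U T)
    (hx : x ∈ U) : cov T X x = (-inner ℝ (cov T S.ξ x) (X x) : ℝ) • S.ξ x +
      (inner ℝ (cov T X x) (S.endo X x) : ℝ) • S.endo X x := by
  have := hX.eq_sum hE hx (cov T X x)
  rwa [hX.inner_cov_self hT hx, zero_smul, add_zero, hX.inner_cov_ξ hT hx] at this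

lemma cov_endo_eq (hX : S.IsAdapted U X) (hE : Module.finrank ℝ E = 3) (hT : SmoothField U T)
    (hx : x ∈ U) : cov T (S.endo X) x = (-inner ℝ (cov T S.ξ x) (S.endo X x) : ℝ) • S.ξ x -
      (inner ℝ (cov T X x) (S.endo X x) : ℝ) • X x := by
  have h := hX.endo.cov_eq hE hT hx
  rw [hX.endo_endo hx, inner_neg_right, hX.inner_cov_endo hT hx] at h
  rw [h]
  module

/-- The equation `R(X, ξ) ξ = κ X` in an adapted frame. -/
lemma riccati (hX : S.IsAdapted U X) (hE : Module.finrank ℝ E = 3) (hκ : S.IsKappa κ)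
    (hx : x ∈ U) {p β a : M → ℝ} (hp : p = fun y ↦ inner ℝ (cov X S.ξ y) (X y))
    (hβ : β = fun y ↦ inner ℝ (cov X S.ξ y) (S.endo X y))
    (ha : a = fun y ↦ inner ℝ (cov S.ξ X y) (S.endo X y)) {γ s : ℝ}
    (hγ : γ = inner ℝ (cov (S.endo X) S.ξ x) (X x))
    (hs : s = inner ℝ (cov (S.endo X) S.ξ x) (S.endo X x)) :
    a x * β x - dirDeriv S.ξ p x - (p x ^ 2 + β x * γ) + a x * γ = κ x ∧
    -a x * p x - dirDeriv S.ξ β x - β x * (p x + s) + a x * s = 0 := by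
  have hξ := S.smoothField_ξ (U := U)
  have hY := hX.endo.smooth
  have h1 : cov S.ξ X x = a x • S.endo X x := by
    rw [hX.cov_eq hE hξ hx, S.cov_ξ_ξ, inner_zero_left, neg_zero, zero_smul, zero_add, ha]
  have h2 : cov S.ξ (S.endo X) x = -a x • X x := by
    rw [hX.cov_endo_eq hE hξ hx, S.cov_ξ_ξ, inner_zero_left, neg_zero, zero_smul, zero_sub, ha,
      neg_smul]
  have h3 : cov X S.ξ x = p x • X x + β x • S.endo X x := by
    rw [hp, hβ]; exact hX.cov_ξ_eq hE hX.smooth hx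
  have h4 : cov (S.endo X) S.ξ x = γ • X x + s • S.endo X x := by
    rw [hγ, hs]; exact hX.cov_ξ_eq hE hY hx
  have iXY : inner ℝ (X x) (S.endo X x) = (0 : ℝ) := S.inner_self_φ _
  have iYX : inner ℝ (S.endo X x) (X x) = (0 : ℝ) := S.inner_φ_self _
  have h5 := S.inner_curvature_ξ hE hX.smooth hX.smooth hx
  have h6 := S.inner_curvature_ξ hE hX.smooth hY hx
  rw [hκ.curvature_ξ hX.smooth (hX.orth x hx) hx, cov_smul_left h1, cov_smul_add_smul h3,
    h4] at h5 h6
  rw [← hp, h1, h3] at h5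
  rw [← hβ, h2, h3] at h6
  simp only [inner_add_left, real_inner_smul_left, real_inner_smul_right,
    hX.unit x hx, hX.endo.unit x hx, iXY, iYX] at h5 h6
  constructor <;> linarith

/-- The covariant derivative of `ξ` in an adapted frame of a `κ`-space. -/
lemma cov_ξ_of_isKappa (hX : S.IsAdapted U X) (hE : Module.finrank ℝ E = 3) (hκ : S.IsKappa κ)
    (hx : x ∈ U) {p q : ℝ} (hp : p = inner ℝ (cov X S.ξ x) (X x))
    (hq : q = inner ℝ (cov X S.ξ x) (S.endo X x) + 1) :
    cov X S.ξ x = p • X x + (q - 1) • S.endo X x ∧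
      cov (S.endo X) S.ξ x = (q + 1) • X x - p • S.endo X x ∧ κ x = 1 - p ^ 2 - q ^ 2 := by
  have hY := hX.endo.smooth
  have hξ := S.smoothField_ξ (U := U)
  have key : ∀ y ∈ U, inner ℝ (cov (S.endo X) S.ξ y) (X y) =
      inner ℝ (cov X S.ξ y) (S.endo X y) + (2 : ℝ) := by
    intro y hy
    have h := S.inner_cov_ξ_sub hX.smooth hY hy
    rw [← S.endo_apply, hX.endo_endo hy, inner_neg_right, hX.unit y hy] at h
    linarith
  have endo_cov : ∀ y ∈ U, cov (S.endo (S.endo X)) S.ξ y = (-1 : ℝ) • cov X S.ξ y := fun y hy ↦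
    cov_smul_left (by rw [hX.endo_endo hy, neg_one_smul])
  have eqs : ∀ y ∈ U, _ ∧ _ := fun y hy ↦ hX.endo.riccati hE hκ hy rfl rfl rfl rfl rfl
  have dβ : ∀ y ∈ U, dirDeriv S.ξ
      (fun y ↦ inner ℝ (cov (S.endo X) S.ξ y) (S.endo (S.endo X) y)) y =
      -dirDeriv S.ξ (fun y ↦ inner ℝ (cov X S.ξ y) (S.endo X y)) y := by
    intro y hy
    have sm := smoothFun_inner (S.smoothField_cov hE hX.smooth hξ) hY
    have h : ∀ y ∈ U, inner ℝ (cov (S.endo X) S.ξ y) (S.endo (S.endo X) y) =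
        -(inner ℝ (cov X S.ξ y) (S.endo X y) + (2 : ℝ)) := fun y hy ↦ by
      rw [hX.endo_endo hy, inner_neg_right, key y hy]
    rw [dirDeriv_congr h hy, dirDeriv_neg, dirDeriv_add sm (SmoothFun.const 2) hy, dirDeriv_const,
      add_zero]
  have trace : ∀ y ∈ U, inner ℝ (cov (S.endo X) S.ξ y) (S.endo X y) =
      -inner ℝ (cov X S.ξ y) (X y) := by
    intro y hy
    have h1 := (hX.riccati hE hκ hy rfl rfl rfl rfl rfl).2
    have h2 := (eqs y hy).2
    simp only [dβ y hy, endo_cov y hy, hX.endo_endo hy, inner_neg_right, real_inner_smul_left,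
      hX.inner_cov_endo hξ hy, key y hy] at h1 h2
    linarith
  have dp : dirDeriv S.ξ (fun y ↦ inner ℝ (cov (S.endo X) S.ξ y) (S.endo X y)) x =
      -dirDeriv S.ξ (fun y ↦ inner ℝ (cov X S.ξ y) (X y)) x := by
    rw [dirDeriv_congr trace hx, dirDeriv_neg]
  have h1 := (hX.riccati hE hκ hx rfl rfl rfl rfl rfl).1
  have h2 := (eqs x hx).1
  simp only [dp, endo_cov x hx, hX.endo_endo hx, inner_neg_right, real_inner_smul_left,
    hX.inner_cov_endo hξ hx, key x hx, trace x hx] at h1 h2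
  have h3 := hX.cov_ξ_eq hE hX.smooth hx
  have h4 := hX.cov_ξ_eq hE hY hx
  rw [key x hx, trace x hx] at h4
  have hβ : inner ℝ (cov X S.ξ x) (S.endo X x) = q - 1 := by rw [hq]; ring
  rw [← hp, hβ] at h1 h2 h3 h4
  refine ⟨h3, ?_, by nlinarith⟩
  rw [h4]
  module

end IsAdapted

end ContactMetricStructure

end Frame

section Sasakian

set_option linter.unusedSectionVars false

variable {E : Type*} [NormedAddCommGroup E] [NormedSpace ℝ E] [FiniteDimensional ℝ E]
  {H : Type*} [TopologicalSpace H] {I : ModelWithCorners ℝ E H}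
  {M : Type*} [TopologicalSpace M] [ChartedSpace H M]
  [RiemannianBundle (fun x : M ↦ TangentSpace I x)]
  [IsManifold I ∞ M] [IsContMDiffRiemannianBundle I ∞ E (fun x : M ↦ TangentSpace I x)]
  {U V : TopologicalSpace.Opens M} {f g κ : M → ℝ} {x : M}
  {X Y Z T W : Π x : M, TangentSpace I x}

lemma lieBracket_self (X : Π x : M, TangentSpace I x) : mlieBracket I X X = 0 := by
  ext x
  have h : mlieBracket I X X x = -mlieBracket I X X x := mlieBracket_swap_apply
  rw [eq_neg_iff_add_eq_zero, ← two_smul ℝ] at h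
  simp_all

namespace ContactMetricStructure

variable {S : ContactMetricStructure I M}

lemma IsKappa.le_one (hE : Module.finrank ℝ E = 3) (hκ : S.IsKappa κ) (x : M) : κ x ≤ 1 := by
  obtain ⟨U, hx, X, hX⟩ := S.exists_isAdapted hE x
  have := (hX.cov_ξ_of_isKappa hE hκ hx rfl rfl).2.2
  nlinarith [sq_nonneg (inner ℝ (cov X S.ξ x) (X x) : ℝ),
    sq_nonneg (inner ℝ (cov X S.ξ x) (S.endo X x) + 1 : ℝ)]

/-- On a `κ`-space, `∇_X ξ = -φ X` at points where `κ = 1`. -/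
lemma IsKappa.cov_ξ_of_eq_one (hE : Module.finrank ℝ E = 3) (hκ : S.IsKappa κ) (hx : κ x = 1) :
    cov X S.ξ x = -S.endo X x := by
  obtain ⟨U, hxU, e, he⟩ := S.exists_isAdapted hE x
  obtain ⟨h1, h2, h3⟩ := he.cov_ξ_of_isKappa hE hκ hxU rfl rfl
  set p : ℝ := inner ℝ (cov e S.ξ x) (e x)
  set q : ℝ := inner ℝ (cov e S.ξ x) (S.endo e x) + 1
  have hp : p = 0 := by nlinarith [sq_nonneg p, sq_nonneg q]
  have hq : q = 0 := by nlinarith [sq_nonneg p, sq_nonneg q]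
  rw [hp, hq, zero_smul, zero_add, zero_sub, neg_one_smul] at h1
  rw [hp, hq, zero_smul, sub_zero, zero_add, one_smul] at h2
  simp only [cov] at h1 h2
  have h0 : leviCivita I M S.ξ x (S.ξ x) = 0 := S.cov_ξ_ξ
  have h4 := he.eq_sum hE hxU (X x)
  rw [← S.endo_apply] at h4
  have h5 : S.φ x (S.endo e x) = -e x := he.φ_φ hxU
  simp only [cov, S.endo_apply]
  rw [h4, map_add, map_add, map_add, map_add, map_smul, map_smul, map_smul, map_smul, map_smul,
    map_smul, h0, h1, h2, S.φ_ξ, h5, S.endo_apply]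
  module

/-- The Reeb field of a `κ`-space with `κ = 1` is a Killing field. -/
lemma IsKappa.isKilling_ξ (hE : Module.finrank ℝ E = 3) (hκ : S.IsKappa κ) (h1 : ∀ x, κ x = 1) :
    IsKilling S.ξ where
  smooth U := S.smoothField_ξ
  lieDeriv_inner {U X Y x} hX hY hx := by
    have hξ := S.smoothField_ξ (U := U)
    rw [dirDeriv_inner hξ hX hY hx, ← cov_sub_cov hξ hX hx, ← cov_sub_cov hξ hY hx,
      hκ.cov_ξ_of_eq_one hE (h1 x), hκ.cov_ξ_of_eq_one hE (h1 x), inner_sub_left,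
      inner_sub_right, inner_neg_left, inner_neg_right, S.endo_apply, S.endo_apply,
      S.inner_φ_left]
    ring

/-- On a three-dimensional Sasakian manifold a Killing field orthogonal to `ξ` is geodesic. -/
lemma cov_self_eq_zero (hE : Module.finrank ℝ E = 3) (hW : IsKilling W)
    (hξW : ∀ x, inner ℝ (S.ξ x) (W x) = (0 : ℝ))
    (hξ : ∀ (X : Π x : M, TangentSpace I x) (x : M), cov X S.ξ x = -S.endo X x)
    (hx : W x ≠ 0) : cov W W x = 0 := by
  have sW := hW.smooth ⊤
  have sξ := S.smoothField_ξ (U := ⊤)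
  have sK := S.smoothField_cov hE sW sW
  have hWξ : ∀ x, inner ℝ (W x) (S.ξ x) = (0 : ℝ) := fun x ↦ by rw [real_inner_comm, hξW]
  have perp : ∀ {X : Π x : M, TangentSpace I x} (x : M), SmoothField ⊤ X →
      inner ℝ (cov X W x) (S.ξ x) = (inner ℝ (W x) (S.endo X x) : ℝ) := by
    intro X x hX
    have h := dirDeriv_inner hX sW sξ (x := x) trivial
    rw [dirDeriv_eq_zero_of_const (U := ⊤) (fun y _ ↦ hWξ y) trivial, hξ, inner_neg_right] at h
    linarith
  have perpK : ∀ y, inner ℝ (cov W W y) (S.ξ y) = (0 : ℝ) := fun y ↦ by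
    rw [perp y sW, S.inner_self_endo]
  have comm : cov W (cov W W) x = cov (cov W W) W x := by
    have h := S.lieBracket_cov hE hW sW sW (x := x) trivial
    rw [lieBracket_self, ← cov_sub_cov sW sK trivial,
      cov_eq_zero_of_eq_zero (U := ⊤) (T := 0) (fun _ _ ↦ rfl) trivial, sub_eq_iff_eq_add] at h
    simpa [cov] using h
  have h1 := S.inner_cov_cov hE sW sW sW sξ (x := x) trivial
  rw [dirDeriv_eq_zero_of_const (U := ⊤) (fun y _ ↦ perpK y) trivial, comm, perp x sK, hξ,
    inner_neg_right, S.endo_apply, S.inner_φ_right, real_inner_comm] at h1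
  have h2 := hW.inner_cov sW sW (x := x) trivial
  rw [real_inner_comm] at h2
  refine S.eq_zero_of_inner hE hx (hξW x) (perpK x) ?_ ?_
  · rw [real_inner_comm]
    linarith
  · rw [S.endo_apply] at h1
    linarith

lemma dirDeriv_inner_self_eq_zero (hE : Module.finrank ℝ E = 3) (hW : IsKilling W)
    (hξW : ∀ x, inner ℝ (S.ξ x) (W x) = (0 : ℝ))
    (hξ : ∀ (X : Π x : M, TangentSpace I x) (x : M), cov X S.ξ x = -S.endo X x)
    (hX : SmoothField U X) (hx : x ∈ U) : dirDeriv X (fun y ↦ inner ℝ (W y) (W y)) x = 0 := by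
  have sW := hW.smooth U
  rw [dirDeriv_inner hX sW sW hx, real_inner_comm (cov X W x) (W x), hW.inner_cov hX sW hx]
  rcases eq_or_ne (W x) 0 with h | h
  · simp [cov, h]
  · simp [cov_self_eq_zero hE hW hξW hξ h]

end ContactMetricStructure

end Sasakian

section NonSasakian

set_option linter.unusedSectionVars false

variable {E : Type*} [NormedAddCommGroup E] [NormedSpace ℝ E] [FiniteDimensional ℝ E]
  {H : Type*} [TopologicalSpace H] {I : ModelWithCorners ℝ E H}
  {M : Type*} [TopologicalSpace M] [ChartedSpace H M]
  [RiemannianBundle (fun x : M ↦ TangentSpace I x)]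
  [IsManifold I ∞ M] [IsContMDiffRiemannianBundle I ∞ E (fun x : M ↦ TangentSpace I x)]
  {U V : TopologicalSpace.Opens M} {f g κ l : M → ℝ} {x : M}
  {X Y Z T W : Π x : M, TangentSpace I x}

lemma dirDeriv_smul_left {v : Π x : M, TangentSpace I x} {a : ℝ}
    (h : v x = a • X x) : dirDeriv v f x = a * dirDeriv X f x := by
  simp only [dirDeriv, h, map_smul, smul_eq_mul]

namespace ContactMetricStructure

/-- The unit vector field `X` is orthogonal to `ξ` and `h X = l X`, where `∇ξ = -φ - φ h`;
moreover `κ = 1 - l ^ 2`, with `0 < l`. -/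
structure IsEigenframe (S : ContactMetricStructure I M) (U : TopologicalSpace.Opens M)
    (κ l : M → ℝ) (X : Π x : M, TangentSpace I x) : Prop extends S.IsAdapted U X where
  smooth_l : SmoothFun I U l
  pos : ∀ x ∈ U, 0 < l x
  κ_eq : ∀ x ∈ U, κ x = 1 - l x ^ 2
  cov_ξ : ∀ x ∈ U, cov X S.ξ x = -(1 + l x) • S.endo X x

variable {S : ContactMetricStructure I M}

lemma exists_isEigenframe_of_field (hT : SmoothField U T) (hx : x ∈ U)
    (hT0 : inner ℝ (T x) (T x) ≠ (0 : ℝ)) (hTξ : ∀ y ∈ U, inner ℝ (S.ξ y) (T y) = (0 : ℝ))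
    (hl : SmoothFun I U l) (hpos : ∀ y ∈ U, 0 < l y) (hlκ : ∀ y ∈ U, κ y = 1 - l y ^ 2)
    (h : ∀ y ∈ U, cov T S.ξ y = -(1 + l y) • S.endo T y) :
    ∃ V : TopologicalSpace.Opens M, x ∈ V ∧ ∃ X, S.IsEigenframe V κ l X := by
  obtain ⟨V, hVU, hxV, f, -, -, hf⟩ := S.exists_isAdapted_of_field hT hx hT0 hTξ
  refine ⟨V, hxV, _, hf, hl.mono hVU, fun y hy ↦ hpos y (hVU hy), fun y hy ↦ hlκ y (hVU hy),
    fun y hy ↦ ?_⟩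
  rw [cov_smul_left (X := T) (a := f y) rfl, h y (hVU hy)]
  simp only [S.endo_apply, Pi.smul_apply', map_smul]
  module

lemma IsKappa.exists_isEigenframe (hE : Module.finrank ℝ E = 3) (hκ : S.IsKappa κ)
    (sκ : ∀ U, SmoothFun I U κ) (hx : κ x < 1) :
    ∃ V : TopologicalSpace.Opens M, x ∈ V ∧ ∃ l X, S.IsEigenframe V κ l X := by
  obtain ⟨U₀, hx₀, e, he⟩ := S.exists_isAdapted hE x
  obtain ⟨W, hW, hWo, hxW⟩ := eventually_nhds_iff.1
    ((sκ ⊤ x trivial).continuousAt.eventually_lt_const hx)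
  let U : TopologicalSpace.Opens M := ⟨W, hWo⟩ ⊓ U₀
  have hxU : x ∈ U := ⟨hxW, hx₀⟩
  replace he := he.mono (V := U) inf_le_right
  have hpos : ∀ y ∈ U, 0 < 1 - κ y := fun y hy ↦ sub_pos.2 (hW y hy.1)
  have sl : SmoothFun I U (fun y ↦ √(1 - κ y)) := ((SmoothFun.const 1).sub (sκ U)).sqrt hpos
  set l : M → ℝ := fun y ↦ √(1 - κ y) with hl
  have lpos : ∀ y ∈ U, 0 < l y := fun y hy ↦ Real.sqrt_pos.2 (hpos y hy)
  have lsq : ∀ y ∈ U, κ y = 1 - l y ^ 2 := fun y hy ↦ by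
    rw [hl, Real.sq_sqrt (hpos y hy).le]; ring
  have sA := S.smoothField_cov hE he.smooth S.smoothField_ξ
  have sp := smoothFun_inner sA he.smooth
  have sq := (smoothFun_inner sA he.endo.smooth).add (SmoothFun.const 1)
  have key := fun y (hy : y ∈ U) ↦ he.cov_ξ_of_isKappa hE hκ hy rfl rfl
  set p : M → ℝ := fun y ↦ inner ℝ (cov e S.ξ y) (e y) with hp
  set q : M → ℝ := fun y ↦ inner ℝ (cov e S.ξ y) (S.endo e y) + 1 with hq
  have h1 : ∀ y ∈ U, cov e S.ξ y = p y • e y + (q y - 1) • S.endo e y := fun y hy ↦ (key y hy).1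
  have h2 : ∀ y ∈ U, cov (S.endo e) S.ξ y = (q y + 1) • e y - p y • S.endo e y :=
    fun y hy ↦ (key y hy).2.1
  have h3 : ∀ y ∈ U, p y ^ 2 + q y ^ 2 = l y ^ 2 := fun y hy ↦ by
    have h := (key y hy).2.2
    rw [lsq y hy] at h
    simp only [hp, hq]
    linarith
  clear_value p q l
  have orth : ∀ (a b : M → ℝ), ∀ y ∈ U, inner ℝ (S.ξ y) ((a • e + b • S.endo e) y) = (0 : ℝ) := by
    intro a b y hy
    simp only [Pi.add_apply, Pi.smul_apply', inner_add_right, real_inner_smul_right, he.orth y hy,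
      he.endo.orth y hy]
    ring
  have norm : ∀ (a b : M → ℝ), inner ℝ ((a • e + b • S.endo e) x) ((a • e + b • S.endo e) x) =
      a x ^ 2 + b x ^ 2 := by
    intro a b
    have iYX : inner ℝ (S.endo e x) (e x) = (0 : ℝ) := S.inner_φ_self _
    simp only [Pi.add_apply, Pi.smul_apply', inner_add_right, real_inner_smul_right,
      inner_add_left, real_inner_smul_left, he.unit x hxU, he.endo.unit x hxU, S.inner_self_endo,
      iYX]
    ring
  have eigen : ∀ (a b : M → ℝ), (∀ y ∈ U, a y * p y + b y * (q y + 1) = (1 + l y) * b y) →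
      (∀ y ∈ U, a y * (q y - 1) - b y * p y = -((1 + l y) * a y)) → ∀ y ∈ U,
      cov (a • e + b • S.endo e) S.ξ y = -(1 + l y) • S.endo (a • e + b • S.endo e) y := by
    intro a b hab hab' y hy
    have h4 : S.endo (a • e + b • S.endo e) y = -b y • e y + a y • S.endo e y := by
      have := he.endo_endo hy
      simp only [S.endo_apply] at this
      simp only [S.endo_apply, Pi.add_apply, Pi.smul_apply', map_add, map_smul, this]
      module
    rw [cov_smul_add_smul (X := e) (Y := S.endo e) rfl, h1 y hy, h2 y hy, h4]
    have h5 : a y • (p y • e y + (q y - 1) • S.endo e y) +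
        b y • ((q y + 1) • e y - p y • S.endo e y) = (a y * p y + b y * (q y + 1)) • e y +
        (a y * (q y - 1) - b y * p y) • S.endo e y := by module
    rw [h5, hab y hy, hab' y hy]
    module
  rcases eq_or_ne (l x - q x) 0 with h0 | h0
  · obtain ⟨V, hxV, X, h⟩ := exists_isEigenframe_of_field (S := S) (κ := κ)
      ((he.smooth.smul sp).add (he.endo.smooth.smul (sl.add sq))) hxU
      (by rw [norm]; nlinarith [lpos x hxU, sq_nonneg (p x)]) (orth _ _) sl lpos lsq
      (eigen _ _ (fun y hy ↦ by linear_combination h3 y hy) fun y hy ↦ by ring)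
    exact ⟨V, hxV, _, X, h⟩
  · obtain ⟨V, hxV, X, h⟩ := exists_isEigenframe_of_field (S := S) (κ := κ)
      ((he.smooth.smul (sl.sub sq)).add (he.endo.smooth.smul sp)) hxU
      (by rw [norm]; positivity) (orth _ _) sl lpos lsq
      (eigen _ _ (fun y hy ↦ by ring) fun y hy ↦ by linear_combination -h3 y hy)
    exact ⟨V, hxV, _, X, h⟩

namespace IsEigenframe

/-- The structure equations of an eigenframe. -/
lemma structure_equations (h : S.IsEigenframe U κ l X) (hE : Module.finrank ℝ E = 3)
    (hκ : S.IsKappa κ) : ∃ b c : M → ℝ, SmoothFun I U b ∧ SmoothFun I U c ∧ ∀ x ∈ U,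
      cov (S.endo X) S.ξ x = (1 - l x) • X x ∧ cov S.ξ X x = 0 ∧ cov S.ξ (S.endo X) x = 0 ∧
      cov X X x = b x • S.endo X x ∧ cov X (S.endo X) x = -b x • X x + (1 + l x) • S.ξ x ∧
      cov (S.endo X) X x = -c x • S.endo X x - (1 - l x) • S.ξ x ∧
      cov (S.endo X) (S.endo X) x = c x • X x ∧ dirDeriv S.ξ l x = 0 := by
  have hX := h.toIsAdapted
  have sX := hX.smooth
  have sY := hX.endo.smooth
  have sξ := S.smoothField_ξ (U := U)
  have iYX : ∀ y, inner ℝ (S.endo X y) (X y) = (0 : ℝ) := fun y ↦ S.inner_φ_self _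
  have p0 : ∀ y ∈ U, inner ℝ (cov X S.ξ y) (X y) = (0 : ℝ) := fun y hy ↦ by
    rw [h.cov_ξ y hy, real_inner_smul_left, iYX, mul_zero]
  have β0 : ∀ y ∈ U, inner ℝ (cov X S.ξ y) (S.endo X y) = -(1 + l y) := fun y hy ↦ by
    rw [h.cov_ξ y hy, real_inner_smul_left, hX.endo.unit y hy, mul_one]
  have hY : ∀ y ∈ U, cov (S.endo X) S.ξ y = (1 - l y) • X y := fun y hy ↦ by
    rw [(hX.cov_ξ_of_isKappa hE hκ hy rfl rfl).2.1, p0 y hy, β0 y hy]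
    module
  have γ0 : ∀ y ∈ U, inner ℝ (cov (S.endo X) S.ξ y) (X y) = 1 - l y := fun y hy ↦ by
    rw [hY y hy, real_inner_smul_left, hX.unit y hy, mul_one]
  have s0 : ∀ y ∈ U, inner ℝ (cov (S.endo X) S.ξ y) (S.endo X y) = (0 : ℝ) := fun y hy ↦ by
    rw [hY y hy, real_inner_smul_left, S.inner_self_endo, mul_zero]
  have ric : ∀ y ∈ U, inner ℝ (cov S.ξ X y) (S.endo X y) = (0 : ℝ) ∧ dirDeriv S.ξ l y = 0 := by
    intro y hy
    obtain ⟨h1, h2⟩ := hX.riccati hE hκ hy rfl rfl rfl rfl rfl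
    rw [dirDeriv_eq_zero_of_const p0 hy, γ0 y hy, h.κ_eq y hy] at h1
    rw [s0 y hy, dirDeriv_congr β0 hy, dirDeriv_neg,
      dirDeriv_add (SmoothFun.const 1) h.smooth_l hy, dirDeriv_const] at h2
    simp only [p0 y hy, β0 y hy] at h1 h2
    refine ⟨?_, by linarith⟩
    have h3 : inner ℝ (cov S.ξ X y) (S.endo X y) * l y = 0 := by linarith
    exact (mul_eq_zero.1 h3).resolve_right (h.pos y hy).ne'
  refine ⟨fun y ↦ inner ℝ (cov X X y) (S.endo X y), fun y ↦ -inner ℝ (cov (S.endo X) X y)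
    (S.endo X y), smoothFun_inner (S.smoothField_cov hE sX sX) sY,
    (smoothFun_inner (S.smoothField_cov hE sY sX) sY).neg, fun y hy ↦
    ⟨hY y hy, ?_, ?_, ?_, ?_, ?_, ?_, (ric y hy).2⟩⟩
  · rw [hX.cov_eq hE sξ hy, (ric y hy).1, S.cov_ξ_ξ]
    simp
  · rw [hX.cov_endo_eq hE sξ hy, (ric y hy).1, S.cov_ξ_ξ]
    simp
  · rw [hX.cov_eq hE sX hy, p0 y hy]
    simp
  · rw [hX.cov_endo_eq hE sX hy, β0 y hy]
    module
  · rw [hX.cov_eq hE sY hy, γ0 y hy]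
    simp only [neg_neg]
    module
  · rw [hX.cov_endo_eq hE sY hy, s0 y hy]
    module

/-- The function `κ` is locally constant where it is less than one, and the curvature of the
contact distribution is `-κ`. -/
lemma dirDeriv_eq_zero (h : S.IsEigenframe U κ l X) (hE : Module.finrank ℝ E = 3)
    (hκ : S.IsKappa κ) (hx : x ∈ U) : (∀ T : Π x : M, TangentSpace I x, dirDeriv T l x = 0) ∧
      inner ℝ (curvature I X (S.endo X) (S.endo X) x) (X x) = -κ x := by
  have : CompleteSpace E := FiniteDimensional.complete ℝ E
  obtain ⟨b, c, sb, sc, eqs⟩ := h.structure_equations hE hκ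
  have hX := h.toIsAdapted
  have sX := hX.smooth
  have sY := hX.endo.smooth
  have sξ := S.smoothField_ξ (U := U)
  have sl := h.smooth_l
  have iYX : ∀ y, inner ℝ (S.endo X y) (X y) = (0 : ℝ) := fun y ↦ S.inner_φ_self _
  have iYξ : ∀ y, inner ℝ (S.endo X y) (S.ξ y) = (0 : ℝ) := fun y ↦ S.inner_φ_ξ _
  have iξY : ∀ y, inner ℝ (S.ξ y) (S.endo X y) = (0 : ℝ) := fun y ↦ S.inner_ξ_φ _
  have iXY : ∀ y, inner ℝ (X y) (S.endo X y) = (0 : ℝ) := fun y ↦ S.inner_self_endo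
  have iXξ : ∀ y ∈ U, inner ℝ (X y) (S.ξ y) = (0 : ℝ) := fun y hy ↦ hX.orth' hy
  have iξX := hX.orth
  have iXX := hX.unit
  have iYY := hX.endo.unit
  have Xξ := h.cov_ξ
  have Yξ := fun y hy ↦ (eqs y hy).1
  have ξX := fun y hy ↦ (eqs y hy).2.1
  have ξY := fun y hy ↦ (eqs y hy).2.2.1
  have XX := fun y hy ↦ (eqs y hy).2.2.2.1
  have XY := fun y hy ↦ (eqs y hy).2.2.2.2.1
  have YX := fun y hy ↦ (eqs y hy).2.2.2.2.2.1
  have YY := fun y hy ↦ (eqs y hy).2.2.2.2.2.2.1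
  have Dξ := fun y hy ↦ (eqs y hy).2.2.2.2.2.2.2
  have bXY : ∀ y ∈ U, mlieBracket I X (S.endo X) y =
      (-b y • X y + c y • S.endo X y) + (2 : ℝ) • S.ξ y := fun y hy ↦ by
    rw [← cov_sub_cov sX sY hy, XY y hy, YX y hy]
    module
  have bξX : ∀ y ∈ U, mlieBracket I S.ξ X y = (1 + l y) • S.endo X y := fun y hy ↦ by
    rw [← cov_sub_cov sξ sX hy, ξX y hy, Xξ y hy]
    module
  have bξY : ∀ y ∈ U, mlieBracket I S.ξ (S.endo X) y = -(1 - l y) • X y := fun y hy ↦ by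
    rw [← cov_sub_cov sξ sY hy, ξY y hy, Yξ y hy]
    module
  have D1 : ∀ {T : Π x : M, TangentSpace I x}, ∀ y ∈ U, dirDeriv T (fun y ↦ 1 + l y) y =
      dirDeriv T l y := fun y hy ↦ by
    rw [dirDeriv_add (SmoothFun.const 1) sl hy, dirDeriv_const, zero_add]
  have D2 : ∀ {T : Π x : M, TangentSpace I x}, ∀ y ∈ U, dirDeriv T (fun y ↦ 1 - l y) y =
      -dirDeriv T l y := fun y hy ↦ by
    rw [dirDeriv_sub (SmoothFun.const 1) sl hy, dirDeriv_const, zero_sub]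
  have codazzi : ∀ y ∈ U, dirDeriv X l y = 2 * l y * c y ∧
      dirDeriv (S.endo X) l y = 2 * l y * b y := by
    intro y hy
    have h0 : curvature I X (S.endo X) S.ξ y = 0 := by
      rw [hκ sX sY hy, iξY, iξX y hy]
      simp
    have h1 : cov (mlieBracket I X (S.endo X)) S.ξ y =
        (-b y * -(1 + l y)) • S.endo X y + (c y * (1 - l y)) • X y := by
      have e1 : cov (mlieBracket I X (S.endo X)) S.ξ y =
          -b y • cov X S.ξ y + c y • cov (S.endo X) S.ξ y + (2 : ℝ) • cov S.ξ S.ξ y := by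
        simp only [cov, bXY y hy, map_add, map_smul]
      rw [e1, Xξ y hy, Yξ y hy, S.cov_ξ_ξ]
      module
    rw [curvature_eq, h1] at h0
    have hX0 := congrArg (fun v ↦ inner ℝ v (X y)) h0
    have hY0 := congrArg (fun v ↦ inner ℝ v (S.endo X y)) h0
    simp only [inner_sub_left, inner_zero_left, S.inner_cov_cov hE sX sY sξ sX hy,
      S.inner_cov_cov hE sY sX sξ sX hy, S.inner_cov_cov hE sX sY sξ sY hy,
      S.inner_cov_cov hE sY sX sξ sY hy] at hX0 hY0
    have e1 : ∀ y ∈ U, inner ℝ (cov (S.endo X) S.ξ y) (X y) = 1 - l y := fun y hy ↦ by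
      rw [Yξ y hy, real_inner_smul_left, iXX y hy, mul_one]
    have e2 : ∀ y ∈ U, inner ℝ (cov (S.endo X) S.ξ y) (S.endo X y) = (0 : ℝ) := fun y hy ↦ by
      rw [Yξ y hy, real_inner_smul_left, iXY y, mul_zero]
    have e3 : ∀ y ∈ U, inner ℝ (cov X S.ξ y) (X y) = (0 : ℝ) := fun y hy ↦ by
      rw [Xξ y hy, real_inner_smul_left, iYX y, mul_zero]
    have e4 : ∀ y ∈ U, inner ℝ (cov X S.ξ y) (S.endo X y) = -(1 + l y) := fun y hy ↦ by
      rw [Xξ y hy, real_inner_smul_left, iYY y hy, mul_one]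
    rw [dirDeriv_congr e1 hy, dirDeriv_eq_zero_of_const e3 hy, D2 y hy] at hX0
    rw [dirDeriv_congr e4 hy, dirDeriv_eq_zero_of_const e2 hy, dirDeriv_neg, D1 y hy] at hY0
    simp only [Xξ y hy, Yξ y hy, XX y hy, YY y hy, XY y hy, YX y hy, inner_add_left,
      inner_add_right, inner_sub_right, real_inner_smul_left, real_inner_smul_right, iXX y hy,
      iYY y hy, iXY, iYX, iYξ, iXξ y hy] at hX0 hY0
    constructor <;> linarith
  have sl2 : SmoothFun I U (fun y ↦ 2 * l y) := (SmoothFun.const 2).mul sl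
  have D2l : ∀ y ∈ U, dirDeriv S.ξ (fun y ↦ 2 * l y) y = 0 := fun y hy ↦ by
    rw [dirDeriv_mul (SmoothFun.const 2) sl hy, dirDeriv_const, Dξ y hy]
    ring
  have DξDX : ∀ y ∈ U, (1 + l y) * b y = dirDeriv S.ξ c y := by
    intro y hy
    have h1 := S.dirDeriv_lieBracket sξ sX sl hy
    rw [dirDeriv_smul_left (bξX y hy), dirDeriv_congr (fun z hz ↦ (codazzi z hz).1) hy,
      dirDeriv_eq_zero_of_const Dξ hy, dirDeriv_mul sl2 sc hy, D2l y hy, (codazzi y hy).2] at h1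
    refine mul_left_cancel₀ (h.pos y hy).ne' ?_
    linarith
  have DξDY : ∀ y ∈ U, -((1 - l y) * c y) = dirDeriv S.ξ b y := by
    intro y hy
    have h1 := S.dirDeriv_lieBracket sξ sY sl hy
    rw [dirDeriv_smul_left (bξY y hy), dirDeriv_congr (fun z hz ↦ (codazzi z hz).2) hy,
      dirDeriv_eq_zero_of_const Dξ hy, dirDeriv_mul sl2 sb hy, D2l y hy, (codazzi y hy).1] at h1
    refine mul_left_cancel₀ (h.pos y hy).ne' ?_
    linarith
  have jac : ∀ y ∈ U, dirDeriv X l y = 0 ∧ dirDeriv (S.endo X) l y = 0 := by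
    intro y hy
    have h1 := jacobi sξ sX sY hy
    have s1 : SmoothFun I U (fun y ↦ 1 + l y) := (SmoothFun.const 1).add sl
    have s2 : SmoothFun I U (fun y ↦ -(1 - l y)) := ((SmoothFun.const 1).sub sl).neg
    have e1 : mlieBracket I S.ξ (mlieBracket I X (S.endo X)) y =
        (-dirDeriv S.ξ b y • X y + -b y • (1 + l y) • S.endo X y) +
        (dirDeriv S.ξ c y • S.endo X y + c y • -(1 - l y) • X y) := by
      rw [lieBracket_congr (fun _ _ ↦ rfl) (Y' := ((fun y ↦ -b y) • X + c • S.endo X) +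
        (fun _ : M ↦ (2 : ℝ)) • S.ξ) bXY hy,
        lieBracket_add_right ((sX.smul sb.neg).add (sY.smul sc)) (sξ.smul (SmoothFun.const 2)) hy,
        lieBracket_add_right (sX.smul sb.neg) (sY.smul sc) hy, lieBracket_smul_right sb.neg sX hy,
        lieBracket_smul_right sc sY hy, lieBracket_smul_right (SmoothFun.const 2) sξ hy,
        dirDeriv_const, dirDeriv_neg, lieBracket_self, bξX y hy, bξY y hy]
      simp
    have e2 : mlieBracket I (mlieBracket I S.ξ X) (S.endo X) y =
        -dirDeriv (S.endo X) l y • S.endo X y := by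
      rw [mlieBracket_swap_apply, lieBracket_congr (fun _ _ ↦ rfl)
        (Y' := (fun y ↦ 1 + l y) • S.endo X) bξX hy, lieBracket_smul_right s1 sY hy,
        lieBracket_self, D1 y hy]
      simp
    have e3 : mlieBracket I X (mlieBracket I S.ξ (S.endo X)) y = dirDeriv X l y • X y := by
      rw [lieBracket_congr (fun _ _ ↦ rfl) (Y' := (fun y ↦ -(1 - l y)) • X) bξY hy,
        lieBracket_smul_right s2 sX hy, lieBracket_self, dirDeriv_neg, D2 y hy]
      simp
    rw [e1, e2, e3, ← DξDX y hy, ← DξDY y hy] at h1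
    have hX0 := congrArg (fun v ↦ inner ℝ v (X y)) h1
    have hY0 := congrArg (fun v ↦ inner ℝ v (S.endo X y)) h1
    simp only [inner_add_left, real_inner_smul_left, iXX y hy, iYX, iXY, iYY y hy] at hX0 hY0
    constructor <;> linarith
  have c0 : ∀ y ∈ U, c y = 0 := fun y hy ↦ by
    have h1 := (codazzi y hy).1
    rw [(jac y hy).1] at h1
    simpa [(h.pos y hy).ne'] using h1.symm
  have b0 : ∀ y ∈ U, b y = 0 := fun y hy ↦ by
    have h1 := (codazzi y hy).2
    rw [(jac y hy).2] at h1
    simpa [(h.pos y hy).ne'] using h1.symm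
  refine ⟨fun T ↦ ?_, ?_⟩
  · have h1 := (jac x hx).1
    have h2 := (jac x hx).2
    have h3 := Dξ x hx
    simp only [dirDeriv, S.endo_apply] at h1 h2 h3 ⊢
    rw [hX.eq_sum hE hx (T x), map_add, map_add, map_smul, map_smul, map_smul, h1, h2, h3]
    simp
  · have e1 : ∀ y ∈ U, inner ℝ (cov (S.endo X) (S.endo X) y) (X y) = (0 : ℝ) := fun y hy ↦ by
      rw [YY y hy, c0 y hy, zero_smul, inner_zero_left]
    have e2 : ∀ y ∈ U, inner ℝ (cov X (S.endo X) y) (X y) = (0 : ℝ) := fun y hy ↦ by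
      rw [XY y hy, b0 y hy, inner_add_left, real_inner_smul_left, real_inner_smul_left, iξX y hy]
      ring
    have e3 : cov (mlieBracket I X (S.endo X)) (S.endo X) x = 0 := by
      have e4 := bXY x hx
      rw [b0 x hx, c0 x hx, neg_zero, zero_smul, zero_smul, add_zero, zero_add] at e4
      rw [cov_smul_left e4, ξY x hx, smul_zero]
    rw [curvature_eq, e3, sub_zero, inner_sub_left, S.inner_cov_cov hE sX sY sY sX hx,
      S.inner_cov_cov hE sY sX sY sX hx, dirDeriv_eq_zero_of_const e1 hx,
      dirDeriv_eq_zero_of_const e2 hx, XY x hx, YX x hx, YY x hx, b0 x hx, c0 x hx, h.κ_eq x hx]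
    simp only [neg_zero, zero_smul, zero_add, zero_sub, inner_zero_left, inner_neg_right,
      real_inner_smul_left, real_inner_smul_right, S.unit_ξ]
    ring

end IsEigenframe

end ContactMetricStructure

end NonSasakian

section Main

set_option linter.unusedSectionVars false

variable {E : Type*} [NormedAddCommGroup E] [NormedSpace ℝ E]
  {H : Type*} [TopologicalSpace H] {I : ModelWithCorners ℝ E H}
  {M : Type*} [TopologicalSpace M] [ChartedSpace H M] [IsManifold I ∞ M]
  {U : TopologicalSpace.Opens M} {f κ l : M → ℝ} {x : M}

lemma eventually_eq_of_dirDeriv_eq_zero [I.Boundaryless] (hf : SmoothFun I U f)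
    (h : ∀ y ∈ U, ∀ T : Π x : M, TangentSpace I x, dirDeriv T f y = 0) (hx : x ∈ U) :
    ∀ᶠ y in nhds x, f y = f x := by
  have h0 : ∀ y ∈ U, mfderiv I 𝓘(ℝ, ℝ) f y = 0 := fun y hy ↦ by
    ext v
    have := h y hy (extend E v)
    rw [dirDeriv, extend_apply_self] at this
    exact this
  have ho : IsOpen ((extChartAt I x).target ∩ (extChartAt I x).symm ⁻¹' U) :=
    (continuousOn_extChartAt_symm x).isOpen_inter_preimage (isOpen_extChartAt_target x) U.isOpen
  have hmem : extChartAt I x x ∈ (extChartAt I x).target ∩ (extChartAt I x).symm ⁻¹' U :=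
    ⟨mem_extChartAt_target x, by simpa using hx⟩
  obtain ⟨r, hr, hball⟩ := Metric.isOpen_iff.1 ho _ hmem
  have hd : ∀ z ∈ Metric.ball (extChartAt I x x) r,
      HasFDerivAt (f ∘ (extChartAt I x).symm) (0 : E →L[ℝ] ℝ) z := by
    intro z hz
    obtain ⟨hz1, hz2⟩ := hball hz
    have h1 : MDifferentiableAt 𝓘(ℝ, E) I (extChartAt I x).symm z := by
      have := (contMDiffOn_extChartAt_symm (I := I) (n := ∞) x).contMDiffAt
        ((isOpen_extChartAt_target x).mem_nhds hz1)
      exact this.mdifferentiableAt (by simp)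
    have h2 := (hf.mdiffAt hz2).hasMFDerivAt.comp z h1.hasMFDerivAt
    rw [h0 _ hz2] at h2
    have h3 := h2.hasFDerivAt
    convert! h3 using 1
  have hc : ∀ z ∈ Metric.ball (extChartAt I x x) r,
      (f ∘ (extChartAt I x).symm) z = f x := by
    intro z hz
    have := Metric.isOpen_ball.is_const_of_fderiv_eq_zero (𝕜 := ℝ)
      (convex_ball _ _).isPreconnected
      (fun w hw ↦ (hd w hw).differentiableAt.differentiableWithinAt)
      (fun w hw ↦ (hd w hw).fderiv) hz (Metric.mem_ball_self hr)
    rw [this]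
    simp
  filter_upwards [(continuousAt_extChartAt (I := I) x).preimage_mem_nhds
      (Metric.ball_mem_nhds _ hr),
    extChartAt_source_mem_nhds (I := I) x] with y hy hys
  have := hc _ hy
  rwa [Function.comp_apply, (extChartAt I x).left_inv hys] at this

variable [FiniteDimensional ℝ E] [RiemannianBundle (fun x : M ↦ TangentSpace I x)]
  [IsContMDiffRiemannianBundle I ∞ E (fun x : M ↦ TangentSpace I x)]
  {X Y Z T W : Π x : M, TangentSpace I x} {S : ContactMetricStructure I M}

namespace ContactMetricStructure

/-- On a connected `κ`-space, `κ` is constant if it is less than one at some point. -/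
lemma IsKappa.eq_of_lt_one [I.Boundaryless] [ConnectedSpace M] (hE : Module.finrank ℝ E = 3)
    (hκ : S.IsKappa κ) (sκ : ∀ U, SmoothFun I U κ) (hx : κ x < 1) (y : M) : κ y = κ x := by
  have hclosed : IsClosed {y | κ y = κ x} :=
    isClosed_eq (continuous_iff_continuousAt.2 fun y ↦ (sκ ⊤ y trivial).continuousAt)
      continuous_const
  have hopen : IsOpen {y | κ y = κ x} := by
    rw [isOpen_iff_mem_nhds]
    intro y (hy : κ y = κ x)
    obtain ⟨V, hyV, l, X, h⟩ := hκ.exists_isEigenframe hE sκ (x := y) (by rwa [hy])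
    have := eventually_eq_of_dirDeriv_eq_zero h.smooth_l
      (fun z hz ↦ (h.dirDeriv_eq_zero hE hκ hz).1) hyV
    filter_upwards [this, V.isOpen.mem_nhds hyV] with z hz hzV
    rw [← hy, h.κ_eq y hyV, h.κ_eq z hzV, hz]
  have := IsClopen.eq_univ ⟨hclosed, hopen⟩ ⟨x, rfl⟩
  exact (this.symm ▸ Set.mem_univ y : y ∈ {y | κ y = κ x})

/-- A Killing field commuting with the Reeb field is an infinitesimal automorphism. -/
lemma isInfinitesimalAutomorphism (hE : Module.finrank ℝ E = 3)
    (hZ : IsInfinitesimalIsometry I Z) (hW : ∀ x, mlieBracket I Z S.ξ x = 0) :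
    S.IsInfinitesimalAutomorphism Z where
  smooth := hZ.smooth
  lieDeriv_metric := hZ.lieDeriv_metric
  lieDeriv_ξ := hW
  lieDeriv_η x X hX := by
    have h := hZ.lieDeriv_metric x S.ξ X (S.smooth_ξ x) hX
    rw [lieDerivMetric, hW, inner_zero_left] at h
    simp only [lieDerivOneForm, S.η_apply]
    linarith
  lieDeriv_φ x X hX := by
    have : CompleteSpace E := FiniteDimensional.complete ℝ E
    have hK := hZ.isKilling
    have smooth_case : ∀ {U : TopologicalSpace.Opens M} {X Y : Π x : M, TangentSpace I x},
        SmoothField U X → SmoothField U Y → x ∈ U →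
        inner ℝ (X x) (mlieBracket I Z (S.endo Y) x) =
          (inner ℝ (X x) (S.φ x (mlieBracket I Z Y x)) : ℝ) := by
      intro U X Y hX hY hx
      have hZU := hK.smooth U
      have sξ := S.smoothField_ξ (U := U)
      have sX := S.smoothField_cov hE hX sξ
      have sY := S.smoothField_cov hE hY sξ
      have key : ∀ y ∈ U, (fun y ↦ inner ℝ (cov X S.ξ y) (Y y) - inner ℝ (cov Y S.ξ y) (X y)) y =
          (fun y ↦ 2 * inner ℝ (X y) (S.endo Y y)) y := fun y hy ↦ S.inner_cov_ξ_sub hX hY hy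
      have h1 := dirDeriv_congr (X := Z) key hx
      have hA : ∀ {X : Π x : M, TangentSpace I x}, SmoothField U X →
          mlieBracket I Z (cov X S.ξ) x = cov (mlieBracket I Z X) S.ξ x := by
        intro X hX
        rw [S.lieBracket_cov hE hK hX sξ hx, cov_eq_zero_of_eq_zero (U := U) (fun y _ ↦ hW y) hx,
          add_zero]
      rw [dirDeriv_sub (smoothFun_inner sX hY) (smoothFun_inner sY hX) hx,
        dirDeriv_mul (SmoothFun.const 2) (smoothFun_inner hX (hY.endo S)) hx, dirDeriv_const,
        hK.lieDeriv_inner sX hY hx, hK.lieDeriv_inner sY hX hx,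
        hK.lieDeriv_inner hX (hY.endo S) hx, hA hX, hA hY] at h1
      have h2 := S.inner_cov_ξ_sub (hZU.lieBracket hX) hY hx
      have h3 := S.inner_cov_ξ_sub hX (hZU.lieBracket hY) hx
      rw [← S.endo_apply] at h2
      linarith
    refine sub_eq_zero.2 (ext_inner_right ℝ fun w ↦ ?_)
    obtain ⟨U, hx, V, hV, rfl⟩ := exists_smoothField w
    have hφX : CMDiffAt ∞ (T% (S.endo X)) x :=
      ContMDiffAt.clm_bundle_apply (E₁ := fun x : M ↦ TangentSpace I x)
        (E₂ := fun x : M ↦ TangentSpace I x) (S.smooth_φ x) hX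
    have h1 := hZ.lieDeriv_metric x _ V hφX (hV x hx)
    have h2 := hZ.lieDeriv_metric x X _ hX ((hV.endo S) x hx)
    have e : (fun y ↦ inner ℝ (S.endo X y) (V y)) = fun y ↦ (-inner ℝ (X y) (S.endo V y) : ℝ) :=
      funext fun y ↦ S.inner_φ_left _ _
    obtain ⟨U', hx', Y, hY, hXY⟩ := exists_smoothField (X x)
    have h3 := smooth_case (hY.mono (V := U ⊓ U') inf_le_right) (hV.mono inf_le_left) ⟨hx, hx'⟩
    rw [hXY, S.inner_φ_right] at h3
    have h4 : dirDeriv Z (fun y ↦ inner ℝ (S.endo X y) (V y)) x =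
        inner ℝ (mlieBracket I Z (S.endo X) x) (V x) +
          inner ℝ (S.endo X x) (mlieBracket I Z V x) := by
      rw [lieDerivMetric] at h1
      rw [dirDeriv]
      linarith
    rw [e, dirDeriv_neg, dirDeriv] at h4
    rw [lieDerivMetric, h3] at h2
    change inner ℝ (mlieBracket I Z (S.endo X) x) (V x) =
      (inner ℝ (S.φ x (mlieBracket I Z X x)) (V x) : ℝ)
    rw [S.inner_φ_left]
    simp only [S.endo_apply] at h2 h4 ⊢
    linarith

/-- On a connected Sasakian three-manifold which is not of constant curvature one, Killing fields
commute with the Reeb field. -/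
lemma lieBracket_eq_zero_of_eq_one [I.Boundaryless] [ConnectedSpace M]
    (hE : Module.finrank ℝ E = 3) (hκ : S.IsKappa κ) (h1 : ∀ x, κ x = 1)
    (hx : scalarCurvature I x ≠ 6) (hZ : IsKilling Z) (y : M) : mlieBracket I Z S.ξ y = 0 := by
  have hξ : HasConstCurvatureAlong 1 S.ξ := fun hX hY hx ↦ by rw [hκ hX hY hx, h1]
  have hW := hZ.lieBracket S (hκ.isKilling_ξ hE h1)
  have hc : HasConstCurvatureAlong 1 (mlieBracket I Z S.ξ) :=
    S.hasConstCurvatureAlong_lieBracket hE hZ hξ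
  have hWx : mlieBracket I Z S.ξ x = 0 := by
    by_contra hne
    refine hx ?_
    rw [S.scalarCurvature_eq hE hξ hc hW.smooth (fun x ↦ S.inner_ξ_lieBracket hZ) hne, mul_one]
  have hloc : IsLocallyConstant
      (fun y ↦ (inner ℝ (mlieBracket I Z S.ξ y) (mlieBracket I Z S.ξ y) : ℝ)) := by
    rw [IsLocallyConstant.iff_eventually_eq]
    intro y
    refine eventually_eq_of_dirDeriv_eq_zero (U := ⊤) (I := I)
      (smoothFun_inner (hW.smooth ⊤) (hW.smooth ⊤)) (fun z _ T ↦ ?_) trivial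
    obtain ⟨U, hz, X, hX, hXT⟩ := exists_smoothField (T z)
    have := dirDeriv_inner_self_eq_zero hE hW (fun x ↦ S.inner_ξ_lieBracket hZ)
      (fun X x ↦ hκ.cov_ξ_of_eq_one hE (h1 x)) hX hz
    rwa [dirDeriv, hXT] at this
  have := hloc.apply_eq_of_preconnectedSpace y x
  rw [hWx, inner_zero_left] at this
  exact inner_self_eq_zero.1 this

/-- On a `κ`-space with `κ` a constant different from `0` and `1`, Killing fields commute with the
Reeb field. -/
lemma lieBracket_eq_zero_of_lt_one {c : ℝ} (hE : Module.finrank ℝ E = 3) (hκ : S.IsKappa κ)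
    (h1 : ∀ x, κ x = c) (hc1 : c < 1) (hc0 : c ≠ 0) (hZ : IsKilling Z) (x : M) :
    mlieBracket I Z S.ξ x = 0 := by
  have : CompleteSpace E := FiniteDimensional.complete ℝ E
  by_contra hne
  have hξ : HasConstCurvatureAlong c S.ξ := fun hX hY hx ↦ by rw [hκ hX hY hx, h1]
  have hc : HasConstCurvatureAlong c (mlieBracket I Z S.ξ) :=
    S.hasConstCurvatureAlong_lieBracket hE hZ hξ
  obtain ⟨V, hxV, l, X, h⟩ := hκ.exists_isEigenframe hE
    (fun U ↦ (SmoothFun.const c).congr fun y _ ↦ h1 y) (x := x) (by rwa [h1])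
  have sX := h.smooth
  have h2 := S.hasConstCurvature_of_ne_zero hE hξ hc ((hZ.smooth V).lieBracket S.smoothField_ξ)
    (fun x _ ↦ S.inner_ξ_lieBracket hZ) sX (sX.endo S) (sX.endo S) hxV hne
  have h3 := (h.dirDeriv_eq_zero hE hκ hxV).2
  have h4 : inner ℝ (S.endo X x) (X x) = (0 : ℝ) := S.inner_φ_self _
  rw [h2, h4, h.toIsAdapted.endo.unit x hxV, zero_smul, sub_zero, one_smul, real_inner_smul_left,
    h.unit x hxV, h1] at h3
  exact hc0 (by linarith)

end ContactMetricStructure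

end Main
end
end KappaSpace

theorem mainTheorem7 {M : Type*} [TopologicalSpace M] [T2Space M] [SecondCountableTopology M]
    [ConnectedSpace M] [ChartedSpace (EuclideanSpace ℝ (Fin 3)) M]
    [IsManifold 𝓘(ℝ, EuclideanSpace ℝ (Fin 3)) ∞ M]
    [RiemannianBundle (fun x : M ↦ TangentSpace 𝓘(ℝ, EuclideanSpace ℝ (Fin 3)) x)]
    [IsContMDiffRiemannianBundle 𝓘(ℝ, EuclideanSpace ℝ (Fin 3)) ∞ (EuclideanSpace ℝ (Fin 3))
      (fun x : M ↦ TangentSpace 𝓘(ℝ, EuclideanSpace ℝ (Fin 3)) x)]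
    (S : KappaSpace.ContactMetricStructure 𝓘(ℝ, EuclideanSpace ℝ (Fin 3)) M)
    (κ : M → ℝ) (hS : S.IsKappaSpace κ)
    (hκ : (∃ x, κ x ≠ 0 ∧ κ x ≠ 1) ∨
      ((∀ x, κ x = 1) ∧
        ∃ x, KappaSpace.scalarCurvature 𝓘(ℝ, EuclideanSpace ℝ (Fin 3)) (M := M) x ≠ 6))
    (Z : Π x : M, TangentSpace 𝓘(ℝ, EuclideanSpace ℝ (Fin 3)) x)
    (hZ : KappaSpace.IsInfinitesimalIsometry 𝓘(ℝ, EuclideanSpace ℝ (Fin 3)) Z) :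
    S.IsInfinitesimalAutomorphism Z := by
  have hE : Module.finrank ℝ (EuclideanSpace ℝ (Fin 3)) = 3 := by simp
  have hκ' : S.IsKappa κ := hS.isKappa
  refine KappaSpace.ContactMetricStructure.isInfinitesimalAutomorphism hE hZ ?_
  rcases hκ with ⟨x, h0, h1⟩ | ⟨h1, x, hx⟩
  · have hlt : κ x < 1 := lt_of_le_of_ne (hκ'.le_one hE x) h1
    exact KappaSpace.ContactMetricStructure.lieBracket_eq_zero_of_lt_one hE hκ'
      (hκ'.eq_of_lt_one hE (fun U y _ ↦ hS.smooth y) hlt) hlt h0 hZ.isKilling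
  · exact KappaSpace.ContactMetricStructure.lieBracket_eq_zero_of_eq_one hE hκ' h1 hx
      hZ.isKilling
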